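/- Let $S$ be a finite set of points in the plane in general position (no three collinear). A plane spanning caterpillar on $S$ is a spanning tree of $S$ whose edges are straight line segments, any two of which meet at most in a common endpoint, and whose non-leaf vertices form a (possibly empty) path. Let $G_{\mathcal C}^{\mathrm{slide}}(S)$ be the graph whose vertices are the plane spanning caterpillars on $S$, where $C_1=(S,E_1)$ and $C_2=(S,E_2)$ are adjacent if $C_2$ arises from $C_1$ by a slide: $E_2=(E_1\setminus\{ab\})\cup\{ac\}$ for some $a,b,c\in S$ with $ab\in E_1$, $ac\notin E_1$ and $bc\in E_1\cap E_2$ such that the triangle $abc$ contains no point of $S$ other than $a,b,c$. For $x\in S$ let $\operatorname{star}(x)$ be the spanning star on $S$ with center $x$. For distinct $u,v\in S$, a plane double star with centers $u$ and $v$ is a plane spanning tree on $S$ that contains the edge $uv$ and in which every vertex other than $u$ and $v$ is a leaf (attached to $u$ or to $v$). (i) If $u,v\in S$ are adjacent on the convex hull of $S$ (that is, $u\ne v$ and the segment $uv$ is an edge of the convex hull), then $\operatorname{star}(u)$ and $\operatorname{star}(v)$ both lie in the same connected component of $G_{\mathcal C}^{\mathrm{slide}}(S)$ as any plane double star with centers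 $u$ and $v$. (ii) The same conclusion holds for arbitrary distinct $u,v\in S$. -/

import Mathlib

namespace CaterpillarSlide

/-- The Euclidean plane. -/
abbrev Plane : Type := EuclideanSpace ℝ (Fin 2)

/-- A finite point set is in general position if no three of its points are collinear. -/
def GeneralPosition (S : Finset Plane) : Prop :=
  ∀ a ∈ S, ∀ b ∈ S, ∀ c ∈ S, a ≠ b → a ≠ c → b ≠ c → ¬ Collinear ℝ ({a, b, c} : Set Plane)

/-- Two distinct points `u`, `v` of `S` are adjacent on the convex hull of `S` if the segment
between them is an edge (an exposed face) of the convex hull. -/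
def HullAdjacent (S : Finset Plane) (u v : S) : Prop :=
  u ≠ v ∧ IsExposed ℝ (convexHull ℝ (S : Set Plane)) (segment ℝ (u : Plane) (v : Plane))

/-- A graph on `S`, drawn with straight line segments as edges, is plane if two distinct edges meet
at most in a common endpoint. -/
def IsPlane {S : Finset Plane} (T : SimpleGraph S) : Prop :=
  ∀ a b c d : S, T.Adj a b → T.Adj c d → s(a, b) ≠ s(c, d) →
    segment ℝ (a : Plane) (b : Plane) ∩ segment ℝ (c : Plane) (d : Plane) ⊆
      ({(a : Plane), (b : Plane)} ∩ {(c : Plane), (d : Plane)} : Set Plane)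

/-- A leaf is a vertex with exactly one neighbour. -/
def IsLeaf {V : Type*} (T : SimpleGraph V) (x : V) : Prop :=
  ∃! y, T.Adj x y

/-- A caterpillar is a tree whose non-leaf vertices form a (possibly empty) path,
listed here in order as `spine`. -/
def IsCaterpillar {V : Type*} (T : SimpleGraph V) : Prop :=
  T.IsTree ∧ ∃ spine : List V,
    spine.Nodup ∧ spine.IsChain T.Adj ∧ ∀ x, x ∈ spine ↔ ¬ IsLeaf T x

/-- The set of all plane spanning caterpillars on `S`. -/
abbrev PlaneCaterpillar (S : Finset Plane) : Type :=
  {T : SimpleGraph S // IsPlane T ∧ IsCaterpillar T}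

/-- The triangle spanned by `a`, `b`, `c` contains no further point of `S`. -/
def EmptyTriangle (S : Finset Plane) (a b c : Plane) : Prop :=
  ∀ p ∈ S, p ∈ convexHull ℝ ({a, b, c} : Set Plane) → p = a ∨ p = b ∨ p = c

/-- `T₂` arises from `T₁` by a slide: an edge `ab` is replaced by a new edge `ac`, where `bc` is an
edge of both graphs and the triangle `abc` is empty. -/
def IsSlide {S : Finset Plane} (T₁ T₂ : SimpleGraph S) : Prop :=
  ∃ a b c : S, a ≠ c ∧ s(a, b) ∈ T₁.edgeSet ∧ s(a, c) ∉ T₁.edgeSet ∧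
    T₂.edgeSet = (T₁.edgeSet \ {s(a, b)}) ∪ {s(a, c)} ∧
    s(b, c) ∈ T₁.edgeSet ∩ T₂.edgeSet ∧
    EmptyTriangle S (a : Plane) (b : Plane) (c : Plane)

theorem IsSlide.symm {S : Finset Plane} {T₁ T₂ : SimpleGraph S} (h : IsSlide T₁ T₂) :
    IsSlide T₂ T₁ := by
  obtain ⟨a, b, c, hac, hab, hac', hE, hbc, ht⟩ := h
  have hne : s(a, b) ≠ s(a, c) := fun h => hac' (h ▸ hab)
  refine ⟨a, c, b, T₁.ne_of_adj hab, ?_, ?_, ?_, ?_, ?_⟩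
  · rw [hE]; exact Or.inr rfl
  · rw [hE]
    rintro (h | h)
    · exact h.2 rfl
    · exact hne h
  · rw [hE]
    ext e
    simp only [Set.mem_union, Set.mem_sdiff, Set.mem_singleton_iff]
    constructor
    · intro he
      by_cases h : e = s(a, b)
      · exact Or.inr h
      · exact Or.inl ⟨Or.inl ⟨he, h⟩, fun h' => hac' (h' ▸ he)⟩
    · rintro (⟨⟨h, -⟩ | h, h'⟩ | h)
      · exact h
      · exact absurd h h'
      · exact h ▸ hab
  · rw [Sym2.eq_swap]; exact ⟨hbc.2, hbc.1⟩
  · intro p hp hpt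
    have := ht p hp (by rwa [Set.pair_comm (b : Plane)])
    tauto

/-- The slide graph of plane spanning caterpillars on `S`. -/
def slideGraph (S : Finset Plane) : SimpleGraph (PlaneCaterpillar S) where
  Adj C D := IsSlide C.1 D.1
  symm := ⟨fun _ _ h => h.symm⟩
  loopless := ⟨by
    rintro C ⟨a, b, c, -, -, h, hE, -⟩
    exact h (hE ▸ Or.inr rfl)⟩

/-- `T` is a double star with centers `u` and `v`: a tree with edge `uv` in which every vertex other
than `u` and `v` is a leaf (by connectedness, a leaf attached to `u` or to `v`). -/
def IsDoubleStar {V : Type*} (T : SimpleGraph V) (u v : V) : Prop :=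
  T.IsTree ∧ T.Adj u v ∧ ∀ x, x ≠ u → x ≠ v → IsLeaf T x

theorem segment_inter_segment_subset {u x y : Plane}
    (h : ¬ Collinear ℝ ({u, x, y} : Set Plane)) :
    segment ℝ u x ∩ segment ℝ u y ⊆ {u} := by
  rintro z ⟨hx, hy⟩
  rw [segment_eq_image'] at hx hy
  obtain ⟨s, -, rfl⟩ := hx
  obtain ⟨t, -, ht⟩ := hy
  simp only [add_right_inj] at ht
  by_cases hs : s = 0
  · simp [hs]
  · exfalso
    apply h
    rw [collinear_iff_of_mem (p₀ := u) (by simp)]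
    refine ⟨y - u, ?_⟩
    have hxu : x - u = (s⁻¹ * t) • (y - u) := by
      rw [mul_smul, ht, smul_smul, inv_mul_cancel₀ hs, one_smul]
    rintro p (rfl | rfl | rfl)
    · exact ⟨0, by simp⟩
    · exact ⟨s⁻¹ * t, by rw [← hxu]; simp⟩
    · exact ⟨1, by simp⟩

theorem isPlane_starGraph {S : Finset Plane} (hS : GeneralPosition S) (u : S) :
    IsPlane (SimpleGraph.starGraph u) := by
  have key : ∀ x y : S, u ≠ x → u ≠ y → x ≠ y →
      segment ℝ (u : Plane) (x : Plane) ∩ segment ℝ (u : Plane) (y : Plane) ⊆ {(u : Plane)} :=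
    fun x y hx hy hxy => segment_inter_segment_subset
      (hS u u.2 x x.2 y y.2 (Subtype.coe_ne_coe.2 hx) (Subtype.coe_ne_coe.2 hy)
        (Subtype.coe_ne_coe.2 hxy))
  intro a b c d hab hcd hne z hz
  rw [SimpleGraph.starGraph_adj] at hab hcd
  obtain ⟨hab, rfl | rfl⟩ := hab <;> obtain ⟨hcd, rfl | rfl⟩ := hcd
  · have := key b d hab hcd (by rintro rfl; exact hne rfl) hz
    simp_all
  · rw [segment_symm ℝ (c : Plane)] at hz
    have := key b c hab hcd.symm (by rintro rfl; exact hne Sym2.eq_swap) hz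
    simp_all
  · rw [segment_symm ℝ (a : Plane)] at hz
    have := key a d hab.symm hcd (by rintro rfl; exact hne Sym2.eq_swap) hz
    simp_all
  · rw [segment_symm ℝ (a : Plane), segment_symm ℝ (c : Plane)] at hz
    have := key a c hab.symm hcd.symm (by rintro rfl; exact hne rfl) hz
    simp_all

theorem isCaterpillar_starGraph {V : Type*} (u : V) :
    IsCaterpillar (SimpleGraph.starGraph u) := by
  refine ⟨SimpleGraph.isTree_starGraph u, ?_⟩
  have hleaf : ∀ x, x ≠ u → IsLeaf (SimpleGraph.starGraph u) x := by
    intro x hx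
    refine ⟨u, by simp [hx], ?_⟩
    intro y hy
    rw [SimpleGraph.starGraph_adj] at hy
    exact hy.2.resolve_left hx
  by_cases hu : IsLeaf (SimpleGraph.starGraph u) u
  · refine ⟨[], by simp, by simp, fun x => ?_⟩
    by_cases hx : x = u
    · subst hx; simpa using hu
    · simpa using hleaf x hx
  · refine ⟨[u], by simp, by simp, fun x => ?_⟩
    by_cases hx : x = u
    · subst hx; simpa using hu
    · simpa [hx] using hleaf x hx

/-- The plane spanning star of `S` with center `u`. -/
def star {S : Finset Plane} (hS : GeneralPosition S) (u : S) : PlaneCaterpillar S :=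
  ⟨SimpleGraph.starGraph u, isPlane_starGraph hS u, isCaterpillar_starGraph u⟩

end CaterpillarSlide

/-! By the symmetry between `u` and `v` it is enough to join a plane double star to `star(u)`. The
leaves of `v` are handed over to `u` step by step (`linked_star`). On one side of `uv`, let `a` be
the leaf of `v` whose direction at `v` is closest to `vu`. By this choice no other leaf of `v` lies
in the triangle `uva`, so the remaining points of `S` in it form a set `Q` of leaves of `u`. Edges
of leaves outside the triangle meet it at most in their center: at `v` by the choice of `a`, at `u`
because an edge passing through would cross `va`. Move `Q` from `u` to `v`, then `Q ∪ {a}` from `v`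
to `u`; now `v` has lost the leaf `a`.

Both moves are instances of `Movable.linked`: if leaves `Z` of a spine vertex `u` lie on one side of
a spine edge `uv`, and the hull of `u`, `v`, `Z` is free of other points and edges, then `Z` can be
moved to `v`. Induct on `Z`. Let `q ∈ Z` be angularly closest to `uv` at `u`. The triangle `uqv` is
empty, so `uv` slides to `qv` and `q` enters the spine. By induction the other leaves move from `u`
to `q`. Those separated from `u` by the line `qv` continue to `v`; the others are blocked by the
edge `uq` and return to `u`. Now `q` has no leaves, `uq` slides to `uv`, `q` becomes a leaf of `v`,
and the leaves still at `u` follow by induction. -/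

namespace CaterpillarSlide

variable {V : Type*} {S : Finset Plane}

/-! ### Signed areas and half-planes -/

/-- Twice the signed area of the triangle `abc`. -/
def orient (a b c : Plane) : ℝ :=
  (b 0 - a 0) * (c 1 - a 1) - (b 1 - a 1) * (c 0 - a 0)

theorem orient_self_left (a b : Plane) : orient a b a = 0 := by simp [orient]

theorem orient_self_right (a b : Plane) : orient a b b = 0 := by
  unfold orient; ring

theorem orient_swap (a b c : Plane) : orient b a c = -orient a b c := by
  unfold orient; ring

theorem orient_rotate (a b c : Plane) : orient b c a = orient a b c := by
  unfold orient; ring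

theorem orient_combo (a b x y : Plane) {s t : ℝ} (h : s + t = 1) :
    orient a b (s • x + t • y) = s * orient a b x + t * orient a b y := by
  obtain rfl : t = 1 - s := by linarith
  simp only [orient, PiLp.add_apply, PiLp.smul_apply, smul_eq_mul]
  ring

theorem collinear_of_orient_eq_zero {a b c : Plane} (h : orient a b c = 0) :
    Collinear ℝ ({a, b, c} : Set Plane) := by
  by_cases hab : a = b
  · subst hab; simpa using collinear_pair ℝ a c
  rw [collinear_iff_of_mem (p₀ := a) (by simp)]
  refine ⟨b - a, ?_⟩
  have hd : b 0 - a 0 ≠ 0 ∨ b 1 - a 1 ≠ 0 := by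
    by_contra! hcon
    apply hab
    ext i
    fin_cases i
    · simpa using (sub_eq_zero.1 hcon.1).symm
    · simpa using (sub_eq_zero.1 hcon.2).symm
  rintro p (rfl | rfl | rfl)
  · exact ⟨0, by simp⟩
  · exact ⟨1, by simp⟩
  · unfold orient at h
    rcases hd with hd | hd
    · refine ⟨(p 0 - a 0) / (b 0 - a 0), ?_⟩
      ext i
      fin_cases i <;> simp <;> field_simp <;> linarith
    · refine ⟨(p 1 - a 1) / (b 1 - a 1), ?_⟩
      ext i
      fin_cases i <;> simp <;> field_simp <;> linarith

theorem GeneralPosition.orient_ne_zero (hS : GeneralPosition S) {a b c : S} (hab : a ≠ b)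
    (hac : a ≠ c) (hbc : b ≠ c) : orient a b c ≠ 0 := fun h =>
  hS a a.2 b b.2 c c.2 (Subtype.coe_ne_coe.2 hab) (Subtype.coe_ne_coe.2 hac)
    (Subtype.coe_ne_coe.2 hbc) (collinear_of_orient_eq_zero h)

theorem convex_orient_nonneg (σ : ℝ) (a b : Plane) :
    Convex ℝ {x : Plane | 0 ≤ σ * orient a b x} := by
  intro x hx y hy s t hs ht hst
  simp only [Set.mem_ofPred_eq] at *
  rw [orient_combo _ _ _ _ hst]
  nlinarith [mul_nonneg hs hx, mul_nonneg ht hy]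

/-- An open half-plane stays convex when a single boundary point is added. This handles hulls that
touch a separating line in exactly one vertex. -/
theorem convex_eq_or_orient_lt (σ : ℝ) (a b w : Plane) :
    Convex ℝ {x : Plane | x = w ∨ σ * orient a b w < σ * orient a b x} := by
  intro x hx y hy s t hs ht hst
  simp only [Set.mem_ofPred_eq] at *
  rcases hs.eq_or_lt with rfl | hs
  · obtain rfl : t = 1 := by linarith
    simpa using hy
  rcases ht.eq_or_lt with rfl | ht
  · obtain rfl : s = 1 := by linarith
    simpa using hx
  rw [orient_combo _ _ _ _ hst]
  obtain rfl : t = 1 - s := by linarith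
  rcases hx with rfl | hx <;> rcases hy with rfl | hy
  · left; rw [← add_smul]; simp
  all_goals right; nlinarith

/-! ### Hulls of vertex sets and planarity -/

/-- The convex hull of a set of points of `S`. -/
def hull (Y : Set S) : Set Plane := convexHull ℝ ((↑) '' Y)

theorem hull_mono {X Y : Set S} (h : X ⊆ Y) : hull X ⊆ hull Y :=
  convexHull_mono (Set.image_mono h)

theorem mem_hull {Y : Set S} {x : S} (h : x ∈ Y) : (x : Plane) ∈ hull Y :=
  subset_convexHull ℝ _ ⟨x, h, rfl⟩

theorem hull_subset {Y : Set S} {K : Set Plane} (hK : Convex ℝ K) (h : ∀ x ∈ Y, (x : Plane) ∈ K) :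
    hull Y ⊆ K :=
  convexHull_min (by rintro _ ⟨x, hx, rfl⟩; exact h x hx) hK

theorem hull_pair (x y : S) : hull {x, y} = segment ℝ (x : Plane) (y : Plane) := by
  rw [hull, Set.image_pair, convexHull_pair]

theorem hull_sym2 (x y : S) : hull (s(x, y) : Set S) = segment ℝ (x : Plane) (y : Plane) := by
  rw [← hull_pair]; congr 1; ext; simp

theorem orient_nonneg_of_mem_hull {Y : Set S} {σ : ℝ} {a b p : Plane} (hp : p ∈ hull Y)
    (h : ∀ x ∈ Y, 0 ≤ σ * orient a b x) : 0 ≤ σ * orient a b p :=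
  hull_subset (convex_orient_nonneg σ a b) h hp

/-- Two hulls on different sides of the line `ab` meet at most in the only point `w` of the first
generating set that lies on the line. -/
theorem hull_inter_hull_subset {X Y : Set S} (σ : ℝ) (a b : Plane) (w : S)
    (hw : orient a b w = 0) (hX : ∀ x ∈ X, x = w ∨ 0 < σ * orient a b x)
    (hY : ∀ y ∈ Y, σ * orient a b y ≤ 0) : hull X ∩ hull Y ⊆ (S : Set Plane) := by
  rintro p ⟨hpX, hpY⟩
  have h1 := hull_subset (convex_eq_or_orient_lt σ a b w) (Y := X)
    (fun x hx => by
      rcases hX x hx with rfl | h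
      · exact Or.inl rfl
      · right; rw [hw]; simpa using h) hpX
  have h2 := orient_nonneg_of_mem_hull (σ := -σ) (a := a) (b := b) hpY
    (fun y hy => by have := hY y hy; linarith)
  rcases h1 with rfl | h
  · exact w.2
  · rw [hw] at h; linarith

/-- Under general position a point of `S` on a segment between points of `S` is an endpoint. -/
theorem GeneralPosition.eq_or_eq_of_mem_segment (hS : GeneralPosition S) {x y z : S}
    (h : (z : Plane) ∈ segment ℝ (x : Plane) y) : z = x ∨ z = y := by
  by_contra! hne
  by_cases hxy : x = y
  · subst hxy; simp at h; exact hne.1 h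
  refine hS.orient_ne_zero hxy hne.1.symm hne.2.symm ?_
  obtain ⟨s, t, -, -, hst, hz⟩ := h
  rw [← hz, orient_combo _ _ _ _ hst, orient_self_left, orient_self_right]; simp

/-- A point of `S` on an edge is an endpoint of it, so a common point of two edges only has to be
shown to lie in `S`. -/
theorem GeneralPosition.isPlane_iff (hS : GeneralPosition S) (T : SimpleGraph S) :
    IsPlane T ↔ ∀ e ∈ T.edgeSet, ∀ e' ∈ T.edgeSet, e ≠ e' →
      hull (e : Set S) ∩ hull (e' : Set S) ⊆ (S : Set Plane) := by
  constructor
  · intro h e he e' he' hne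
    induction e with | _ a b
    induction e' with | _ c d
    rw [hull_sym2, hull_sym2]
    intro z hz
    rcases (h a b c d he he' hne hz).1 with rfl | rfl
    · exact a.2
    · exact b.2
  · intro h a b c d hab hcd hne z hz
    have hzS := h s(a, b) hab s(c, d) hcd hne (by rwa [hull_sym2, hull_sym2])
    lift z to S using hzS
    have h1 := hS.eq_or_eq_of_mem_segment hz.1
    have h2 := hS.eq_or_eq_of_mem_segment hz.2
    exact ⟨h1.imp (congrArg _) (congrArg _), h2.imp (congrArg _) (congrArg _)⟩

theorem GeneralPosition.hull_inter_hull_subset_of_mem (hS : GeneralPosition S) {e e' : Sym2 S}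
    {x : S} (hne : e ≠ e') (hx : x ∈ e) (hx' : x ∈ e') :
    hull (e : Set S) ∩ hull (e' : Set S) ⊆ (S : Set Plane) := by
  obtain ⟨a, rfl⟩ := hx
  obtain ⟨b, rfl⟩ := hx'
  have hab : a ≠ b := by rintro rfl; exact hne rfl
  rw [hull_sym2, hull_sym2]
  by_cases hxa : x = a
  · subst hxa
    rintro z ⟨hz, -⟩
    simp at hz
    exact hz ▸ x.2
  by_cases hxb : x = b
  · subst hxb
    rintro z ⟨-, hz⟩
    simp at hz
    exact hz ▸ x.2
  intro z hz
  have := segment_inter_segment_subset (hS x x.2 a a.2 b b.2 (Subtype.coe_ne_coe.2 hxa)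
    (Subtype.coe_ne_coe.2 hxb) (Subtype.coe_ne_coe.2 hab)) hz
  rw [Set.mem_singleton_iff] at this
  exact this ▸ x.2

/-- Replacing edges by one new edge that crosses none of the remaining ones keeps a graph plane. -/
theorem GeneralPosition.isPlane_of_subset_insert (hS : GeneralPosition S) {T T' : SimpleGraph S}
    (hT : IsPlane T) {e₀ : Sym2 S} (hsub : T'.edgeSet ⊆ insert e₀ T.edgeSet)
    (h : ∀ e ∈ T'.edgeSet, e ≠ e₀ → hull (e : Set S) ∩ hull (e₀ : Set S) ⊆ (S : Set Plane)) :
    IsPlane T' := by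
  rw [hS.isPlane_iff] at hT ⊢
  intro e he e' he' hne
  by_cases h0 : e = e₀
  · subst h0
    rw [Set.inter_comm]
    exact h e' he' hne.symm
  by_cases h0' : e' = e₀
  · subst h0'
    exact h e he hne
  exact hT e ((hsub he).resolve_left h0) e' ((hsub he').resolve_left h0') hne

/-- Among points on one side of `uv` there is one whose ray from `u` is angularly closest to the
ray `uv`. -/
theorem GeneralPosition.exists_min_angle (hS : GeneralPosition S) {Z : Set S} (hZ : Z.Nonempty)
    (σ : ℝ) (u v : S) (hside : ∀ z ∈ Z, 0 < σ * orient u v z) :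
    ∃ q ∈ Z, ∀ z ∈ Z, z ≠ q → 0 < σ * orient u q z := by
  have hne_u : ∀ z ∈ Z, u ≠ z := by
    rintro z hz rfl
    have := hside u hz
    rw [orient_self_left] at this
    simp at this
  -- `D z` is the inner product of `z - u` and `v - u`; its quotient by the cross product is, up to
  -- a positive factor, the cotangent of the angle at `u`, so the maximum gives the smallest angle.
  let D : S → ℝ := fun z => ((z : Plane) 0 - (u : Plane) 0) * ((v : Plane) 0 - (u : Plane) 0) +
    ((z : Plane) 1 - (u : Plane) 1) * ((v : Plane) 1 - (u : Plane) 1)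
  obtain ⟨q, hq, hmax⟩ := Set.exists_max_image Z (fun z => D z / (σ * orient u v z)) Z.toFinite hZ
  refine ⟨q, hq, fun z hz hzq => ?_⟩
  have h1 := hmax z hz
  have hne := hS.orient_ne_zero (hne_u q hq) (hne_u z hz) hzq.symm
  have hq0 := hside q hq
  have hz0 := hside z hz
  rw [div_le_div_iff₀ hz0 hq0] at h1
  have hσ : σ ≠ 0 := by rintro rfl; simp at hq0
  have hid : (((v : Plane) 0 - (u : Plane) 0) ^ 2 + ((v : Plane) 1 - (u : Plane) 1) ^ 2) *
      (σ * orient u q z) = D q * (σ * orient u v z) - D z * (σ * orient u v q) := by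
    simp only [D, orient]; ring
  have hpos : 0 ≤ ((v : Plane) 0 - (u : Plane) 0) ^ 2 + ((v : Plane) 1 - (u : Plane) 1) ^ 2 := by
    positivity
  have hnn : ((v : Plane) 0 - (u : Plane) 0) ^ 2 + ((v : Plane) 1 - (u : Plane) 1) ^ 2 ≠ 0 := by
    intro h0
    have ha : (v : Plane) 0 - (u : Plane) 0 = 0 := by nlinarith
    have hb : (v : Plane) 1 - (u : Plane) 1 = 0 := by nlinarith
    simp [orient, ha, hb] at hq0
  have hle : 0 ≤ σ * orient u q z := by
    by_contra! hneg
    nlinarith [mul_neg_of_pos_of_neg (lt_of_le_of_ne hpos hnn.symm) hneg]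
  exact lt_of_le_of_ne hle (mul_ne_zero hσ hne).symm

/-! ### Trees, slides and caterpillars -/

/-- The path `a`, `c`, `b` replaces the lost edge `ab`, so connectedness survives, and the number of
edges does not change. -/
theorem IsSlide.isTree {T T' : SimpleGraph S} (h : IsSlide T T') (hT : T.IsTree) : T'.IsTree := by
  obtain ⟨a, b, c, hac, hab, hac', hE, hbc, -⟩ := h
  have hadj : ∀ x y, T'.Adj x y ↔ (T.Adj x y ∧ s(x, y) ≠ s(a, b)) ∨ s(x, y) = s(a, c) := by
    intro x y
    rw [← SimpleGraph.mem_edgeSet, hE]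
    rfl
  rw [SimpleGraph.isTree_iff_connected_and_card] at hT ⊢
  obtain ⟨hconn, hcard⟩ := hT
  have hreach : T'.Reachable a b := by
    have h1 : T'.Adj a c := (hadj a c).2 (Or.inr rfl)
    have h2 : T'.Adj b c := hbc.2
    exact h1.reachable.trans h2.symm.reachable
  have hstep : ∀ x y, T.Adj x y → T'.Reachable x y := by
    intro x y hxy
    by_cases hs : s(x, y) = s(a, b)
    · rcases Sym2.eq_iff.1 hs with ⟨rfl, rfl⟩ | ⟨rfl, rfl⟩
      · exact hreach
      · exact hreach.symm
    · exact ((hadj x y).2 (Or.inl ⟨hxy, hs⟩)).reachable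
  refine ⟨?_, ?_⟩
  · have := hconn.nonempty
    refine ⟨fun x y => ?_⟩
    obtain ⟨w⟩ := hconn.preconnected x y
    induction w with
    | nil => exact SimpleGraph.Reachable.refl _
    | cons h _ ih => exact (hstep _ _ h).trans ih
  · rw [← hcard, hE, Set.union_singleton, Nat.card_coe_set_eq, Nat.card_coe_set_eq,
      Set.ncard_exchange hac' hab]

theorem not_isLeaf {T : SimpleGraph V} {x y z : V} (hy : T.Adj x y) (hz : T.Adj x z)
    (hne : y ≠ z) : ¬ IsLeaf T x := fun ⟨_, _, h⟩ => hne ((h y hy).trans (h z hz).symm)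

/-- A tree with a path meeting every non-leaf is a caterpillar. -/
theorem isCaterpillar_of_spine {T : SimpleGraph V} (hT : T.IsTree) {l : List V} (hl : l.Nodup)
    (hc : l.IsChain T.Adj) (hleaf : ∀ x, x ∉ l → IsLeaf T x) : IsCaterpillar T := by
  classical
  refine ⟨hT, l.filter (fun x => ¬ IsLeaf T x), hl.filter _, ?_, fun x => ?_⟩
  · rcases l with _ | ⟨x, l⟩
    · simp
    rcases List.eq_nil_or_concat l with rfl | ⟨m, y, rfl⟩
    · by_cases h : IsLeaf T x <;> simp [h]
    -- An inner vertex of the list has two distinct neighbours on it, so only the two ends can be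
    -- leaves and removing leaves yields an infix.
    have hm : m.filter (fun x => ¬ IsLeaf T x) = m := by
      rw [List.filter_eq_self]
      intro z hz
      obtain ⟨m₁, m₂, rfl⟩ := List.append_of_mem hz
      obtain ⟨p, m₁', hp⟩ : ∃ p m₁', x :: m₁ = m₁' ++ [p] := by
        rcases List.eq_nil_or_concat (x :: m₁) with h | ⟨m', p, h⟩
        · simp at h
        · exact ⟨p, m', by simpa using h⟩
      obtain ⟨n, m₂', hn⟩ : ∃ n m₂', m₂ ++ [y] = n :: m₂' := by
        rcases m₂ with _ | ⟨n, m₂⟩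
        · exact ⟨y, [], rfl⟩
        · exact ⟨n, m₂ ++ [y], rfl⟩
      have heq : x :: (m₁ ++ z :: m₂).concat y = m₁' ++ p :: z :: n :: m₂' := by
        have : x :: (m₁ ++ z :: m₂).concat y = (x :: m₁) ++ z :: (m₂ ++ [y]) := by simp
        rw [this, hp, hn]; simp
      rw [heq] at hl hc
      have hc' : List.IsChain T.Adj [p, z, n] := hc.infix ⟨m₁', m₂', by simp⟩
      have hl' : [p, z, n].Nodup := hl.sublist
        (List.IsInfix.sublist ⟨m₁', m₂', by simp⟩)
      simp at hc' hl'
      simpa using not_isLeaf hc'.1.symm hc'.2 hl'.1.2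
    refine hc.infix ?_
    rw [List.concat_eq_append, ← List.singleton_append, List.filter_append, List.filter_append, hm]
    by_cases hx : IsLeaf T x <;> by_cases hy : IsLeaf T y <;> simp [hx, hy]
    · exact ⟨[x], [y], by simp⟩
    · exact (List.suffix_cons _ _).isInfix
    · exact ⟨[], [y], by simp⟩
  · simp only [List.mem_filter, decide_eq_true_eq]
    exact ⟨fun h => h.2, fun h => ⟨by_contra fun hx => h (hleaf x hx), h⟩⟩

/-! ### Caterpillars given by a spine and an attachment map -/

/-- The edges between consecutive vertices of a list. -/
def pathEdges : List V → Set (Sym2 V)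
  | a :: b :: l => insert s(a, b) (pathEdges (b :: l))
  | _ => ∅

@[simp] theorem pathEdges_cons_cons (a b : V) (l : List V) :
    pathEdges (a :: b :: l) = insert s(a, b) (pathEdges (b :: l)) := rfl

@[simp] theorem pathEdges_singleton (a : V) : pathEdges [a] = ∅ := rfl

theorem pathEdges_append_cons (l m : List V) (u : V) :
    pathEdges (l ++ u :: m) = pathEdges (l ++ [u]) ∪ pathEdges (u :: m) := by
  induction l with
  | nil => simp
  | cons a l ih =>
    rcases l with _ | ⟨b, l⟩
    · simp
    · simp only [List.cons_append, pathEdges_cons_cons] at ih ⊢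
      rw [ih, Set.insert_union]

theorem pathEdges_reverse (l : List V) : pathEdges l.reverse = pathEdges l := by
  induction l with
  | nil => rfl
  | cons a l ih =>
    rcases l with _ | ⟨b, l⟩
    · rfl
    · rw [pathEdges_cons_cons, ← ih, List.reverse_cons, List.reverse_cons, List.append_assoc,
        List.singleton_append, pathEdges_append_cons]
      simp [Sym2.eq_swap]

theorem mem_of_mem_pathEdges {l : List V} {e : Sym2 V} (he : e ∈ pathEdges l) {x : V}
    (hx : x ∈ e) : x ∈ l := by
  induction l with
  | nil => exact he.elim
  | cons a l ih =>
    rcases l with _ | ⟨b, l⟩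
    · exact he.elim
    · rcases he with rfl | he
      · rcases Sym2.mem_iff.1 hx with rfl | rfl <;> simp
      · exact List.mem_cons_of_mem _ (ih he)

theorem not_isDiag_of_mem_pathEdges {l : List V} (hl : l.Nodup) {e : Sym2 V}
    (he : e ∈ pathEdges l) : ¬ e.IsDiag := by
  induction l with
  | nil => exact he.elim
  | cons a l ih =>
    rcases l with _ | ⟨b, l⟩
    · exact he.elim
    · rcases he with rfl | he
      · rw [Sym2.mk_isDiag_iff]; rintro rfl; simp at hl
      · exact ih hl.of_cons he

theorem isChain_pathEdges (l : List V) : l.IsChain (fun x y => s(x, y) ∈ pathEdges l) := by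
  induction l with
  | nil => simp
  | cons a l ih =>
    rcases l with _ | ⟨b, l⟩
    · simp
    · rw [List.isChain_cons_cons]
      exact ⟨by simp, ih.imp fun _ _ h => Or.inr h⟩

/-- A spine `l` and an assignment `f` of the remaining vertices to vertices of the spine. -/
structure IsLayout (l : List V) (f : V → V) : Prop where
  nodup : l.Nodup
  maps : ∀ x, x ∉ l → f x ∈ l

/-- The edges of the caterpillar with spine `l` in which each `x ∉ l` is a leaf attached to
`f x`. -/
def layoutEdges (l : List V) (f : V → V) : Set (Sym2 V) :=
  pathEdges l ∪ {e | ∃ x, x ∉ l ∧ e = s(x, f x)}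

/-- The caterpillar with spine `l` in which each `x ∉ l` is a leaf attached to `f x`. -/
def layoutGraph (l : List V) (f : V → V) : SimpleGraph V :=
  SimpleGraph.fromEdgeSet (layoutEdges l f)

theorem IsLayout.edgeSet {l : List V} {f : V → V} (h : IsLayout l f) :
    (layoutGraph l f).edgeSet = layoutEdges l f := by
  rw [layoutGraph, SimpleGraph.edgeSet_fromEdgeSet, sdiff_eq_left, Set.disjoint_left]
  rintro e (he | ⟨x, hx, rfl⟩) hd
  · exact not_isDiag_of_mem_pathEdges h.nodup he hd
  · have : x = f x := hd
    exact hx (this ▸ h.maps x hx)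

theorem IsLayout.adj_iff {l : List V} {f : V → V} (h : IsLayout l f) {x y : V} :
    (layoutGraph l f).Adj x y ↔ s(x, y) ∈ layoutEdges l f := by
  rw [← SimpleGraph.mem_edgeSet, h.edgeSet]

theorem IsLayout.isCaterpillar {l : List V} {f : V → V} (h : IsLayout l f)
    (hT : (layoutGraph l f).IsTree) : IsCaterpillar (layoutGraph l f) := by
  refine isCaterpillar_of_spine hT h.nodup
    ((isChain_pathEdges l).imp fun x y hxy => h.adj_iff.2 (Or.inl hxy)) fun x hx => ?_
  refine ⟨f x, h.adj_iff.2 (Or.inr ⟨x, hx, rfl⟩), fun y hy => ?_⟩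
  rcases h.adj_iff.1 hy with he | ⟨z, hz, he⟩
  · exact absurd (mem_of_mem_pathEdges he (by simp)) hx
  · rcases Sym2.eq_iff.1 he with ⟨rfl, rfl⟩ | ⟨hxz, -⟩
    · rfl
    · exact absurd (hxz ▸ h.maps z hz) hx

theorem IsLayout.reverse {l : List V} {f : V → V} (h : IsLayout l f) : IsLayout l.reverse f :=
  ⟨List.nodup_reverse.2 h.nodup, fun x hx => by simpa using h.maps x (by simpa using hx)⟩

theorem layoutGraph_reverse (l : List V) (f : V → V) :
    layoutGraph l.reverse f = layoutGraph l f := by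
  simp [layoutGraph, layoutEdges, pathEdges_reverse]

/-- The values of the attachment map on the spine are irrelevant, so they may be prescribed before a
vertex leaves the spine. -/
theorem layoutGraph_congr {l : List V} {f g : V → V} (h : ∀ x, x ∉ l → f x = g x) :
    layoutGraph l f = layoutGraph l g := by
  unfold layoutGraph layoutEdges
  congr 2
  ext e
  constructor <;> rintro ⟨x, hx, rfl⟩
  · exact ⟨x, hx, by rw [h x hx]⟩
  · exact ⟨x, hx, by rw [h x hx]⟩

open Classical in
/-- Attach all vertices of `Z` to `v` instead. -/
noncomputable def reattach (Z : Set V) (v : V) (f : V → V) (x : V) : V :=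
  if x ∈ Z then v else f x

theorem reattach_of_mem {Z : Set V} {v : V} {f : V → V} {x : V} (h : x ∈ Z) :
    reattach Z v f x = v := if_pos h

theorem reattach_of_notMem {Z : Set V} {v : V} {f : V → V} {x : V} (h : x ∉ Z) :
    reattach Z v f x = f x := if_neg h

theorem IsLayout.reattach {l : List V} {f : V → V} (h : IsLayout l f) {v : V} (hv : v ∈ l)
    (Z : Set V) : IsLayout l (reattach Z v f) := by
  refine ⟨h.nodup, fun x hx => ?_⟩
  by_cases hZ : x ∈ Z
  · rwa [reattach_of_mem hZ]
  · rw [reattach_of_notMem hZ]; exact h.maps x hx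

/-! ### Elementary slides: a leaf enters or leaves the spine -/

/-- Both graphs are plane spanning caterpillars, connected by slides. -/
def Linked (T T' : SimpleGraph S) : Prop :=
  ∃ (h : IsPlane T ∧ IsCaterpillar T) (h' : IsPlane T' ∧ IsCaterpillar T'),
    (slideGraph S).Reachable ⟨T, h⟩ ⟨T', h'⟩

theorem Linked.trans {T₁ T₂ T₃ : SimpleGraph S} (h : Linked T₁ T₂) (h' : Linked T₂ T₃) :
    Linked T₁ T₃ := by
  obtain ⟨h₁, _, r⟩ := h
  obtain ⟨_, h₃, r'⟩ := h'
  exact ⟨h₁, h₃, r.trans r'⟩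

theorem Linked.right {T₁ T₂ : SimpleGraph S} (h : Linked T₁ T₂) : Linked T₂ T₂ := by
  obtain ⟨_, h₂, _⟩ := h
  exact ⟨h₂, h₂, SimpleGraph.Reachable.refl _⟩

theorem Linked.isPlane {T : SimpleGraph S} (h : Linked T T) : IsPlane T := h.1.1

theorem Linked.slide {T : SimpleGraph S} (hT : Linked T T) {l : List S} {f : S → S}
    (hl : IsLayout l f) (hs : IsSlide T (layoutGraph l f)) (hp : IsPlane (layoutGraph l f)) :
    Linked T (layoutGraph l f) := by
  obtain ⟨h, -, -⟩ := hT
  have h' : IsPlane (layoutGraph l f) ∧ IsCaterpillar (layoutGraph l f) :=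
    ⟨hp, hl.isCaterpillar (hs.isTree h.2.1)⟩
  have hadj : (slideGraph S).Adj ⟨T, h⟩ ⟨_, h'⟩ := hs
  exact ⟨h, h', hadj.reachable⟩

theorem IsLayout.insert {l₁ l₂ : List V} {u v q : V} {f : V → V}
    (h : IsLayout (l₁ ++ u :: v :: l₂) f) (hq : q ∉ l₁ ++ u :: v :: l₂) :
    IsLayout (l₁ ++ u :: q :: v :: l₂) f := by
  refine ⟨?_, fun x hx => ?_⟩
  · have hp : (l₁ ++ u :: q :: v :: l₂).Perm (q :: (l₁ ++ u :: v :: l₂)) := by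
      have := List.perm_middle (a := q) (l₁ := l₁ ++ [u]) (l₂ := v :: l₂)
      simpa using this
    rw [hp.nodup_iff, List.nodup_cons]
    exact ⟨hq, h.nodup⟩
  · have := h.maps x (by simp at hx ⊢; tauto)
    simp at this ⊢; tauto

/-- The edges of a layout other than the spine edge `uv` and the leaf edges at `Z`. -/
def otherEdges (l₁ : List V) (u v : V) (l₂ : List V) (f : V → V) (Z : Set V) : Set (Sym2 V) :=
  pathEdges (l₁ ++ [u]) ∪ pathEdges (v :: l₂) ∪
    {e | ∃ x, x ∉ l₁ ++ u :: v :: l₂ ∧ x ∉ Z ∧ e = s(x, f x)}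

/-- Read backwards, the spine has `u` as the successor of `v`; this lets statements about moving
forward serve for moving back. -/
theorem otherEdges_reverse (l₁ l₂ : List V) (u v : V) (f : V → V) (Z : Set V) :
    otherEdges l₂.reverse v u l₁.reverse f Z = otherEdges l₁ u v l₂ f Z := by
  have h1 : l₂.reverse ++ [v] = (v :: l₂).reverse := by simp
  have h2 : u :: l₁.reverse = (l₁ ++ [u]).reverse := by simp
  unfold otherEdges
  rw [h1, h2, pathEdges_reverse, pathEdges_reverse, Set.union_comm (pathEdges _)]
  congr 1
  ext e
  refine exists_congr fun x => and_congr_left fun _ => not_congr ?_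
  simp; tauto

/-- Together with `layoutEdges_insert_eq` this isolates the slide: both graphs contain `otherEdges`
and `uq`, and they differ only in `uv` against `vq`. -/
theorem layoutEdges_eq (l₁ l₂ : List V) {u v q : V} {f : V → V} (hq : q ∉ l₁ ++ u :: v :: l₂)
    (hf : f q = u) : layoutEdges (l₁ ++ u :: v :: l₂) f =
      otherEdges l₁ u v l₂ f {q} ∪ {s(u, v), s(u, q)} := by
  unfold layoutEdges otherEdges
  rw [pathEdges_append_cons, pathEdges_cons_cons]
  ext e
  constructor
  · rintro ((he | rfl | he) | ⟨x, hx, rfl⟩)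
    · exact Or.inl (Or.inl (Or.inl he))
    · exact Or.inr (Or.inl rfl)
    · exact Or.inl (Or.inl (Or.inr he))
    · by_cases hxq : x = q
      · subst hxq
        rw [hf]
        exact Or.inr (Or.inr Sym2.eq_swap)
      · exact Or.inl (Or.inr ⟨x, hx, hxq, rfl⟩)
  · rintro (((he | he) | ⟨x, hx, -, rfl⟩) | (rfl | rfl))
    · exact Or.inl (Or.inl he)
    · exact Or.inl (Or.inr (Or.inr he))
    · exact Or.inr ⟨x, hx, rfl⟩
    · exact Or.inl (Or.inr (Or.inl rfl))
    · exact Or.inr ⟨q, hq, by rw [hf]; exact Sym2.eq_swap⟩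

theorem layoutEdges_insert_eq (l₁ l₂ : List V) (u v q : V) (f : V → V) :
    layoutEdges (l₁ ++ u :: q :: v :: l₂) f =
      otherEdges l₁ u v l₂ f {q} ∪ {s(u, q), s(v, q)} := by
  unfold layoutEdges otherEdges
  rw [pathEdges_append_cons, pathEdges_cons_cons, pathEdges_cons_cons]
  ext e
  constructor
  · rintro ((he | rfl | rfl | he) | ⟨x, hx, rfl⟩)
    · exact Or.inl (Or.inl (Or.inl he))
    · exact Or.inr (Or.inl rfl)
    · exact Or.inr (Or.inr Sym2.eq_swap)
    · exact Or.inl (Or.inl (Or.inr he))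
    · refine Or.inl (Or.inr ⟨x, ?_, ?_, rfl⟩) <;> simp at hx ⊢ <;> tauto
  · rintro (((he | he) | ⟨x, hx, hxq, rfl⟩) | (rfl | rfl))
    · exact Or.inl (Or.inl he)
    · exact Or.inl (Or.inr (Or.inr (Or.inr he)))
    · exact Or.inr ⟨x, by simp at hx hxq ⊢; tauto, rfl⟩
    · exact Or.inl (Or.inr (Or.inl rfl))
    · exact Or.inl (Or.inr (Or.inr (Or.inl Sym2.eq_swap)))

theorem notMem_otherEdges {l₁ l₂ : List V} {u v : V} {f : V → V}
    (h : IsLayout (l₁ ++ u :: v :: l₂) f) {q : V} (hq : q ∉ l₁ ++ u :: v :: l₂) {e : Sym2 V}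
    (hqe : q ∈ e) : e ∉ otherEdges l₁ u v l₂ f {q} := by
  rintro ((he | he) | ⟨x, hx, hxq, rfl⟩)
  · have := mem_of_mem_pathEdges he hqe
    simp at this hq; tauto
  · have := mem_of_mem_pathEdges he hqe
    simp at this hq; tauto
  · rcases Sym2.mem_iff.1 hqe with rfl | hq'
    · exact hxq rfl
    · exact hq (hq' ▸ h.maps x hx)

theorem IsLayout.spineEdge_notMem_otherEdges {l₁ l₂ : List V} {u v : V} {f : V → V}
    (h : IsLayout (l₁ ++ u :: v :: l₂) f) (Z : Set V) :
    s(v, u) ∉ otherEdges l₁ u v l₂ f Z := by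
  have hn := h.nodup
  rw [List.nodup_append] at hn
  rintro ((he | he) | ⟨x, hx, -, he⟩)
  · have hv := mem_of_mem_pathEdges he (x := v) (by simp)
    rcases List.mem_append.1 hv with hv | hv
    · exact hn.2.2 v hv v (by simp) rfl
    · simp at hv; subst hv; simp at hn
  · have hv := mem_of_mem_pathEdges he (x := u) (by simp)
    exact (List.nodup_cons.1 hn.2.1).1 hv
  · apply hx
    have : x ∈ s(v, u) := he ▸ Sym2.mem_mk_left _ _
    simp at this ⊢; tauto

/-- The edge `vu` slides along `uq` to `vq`, which turns the leaf `q` into a spine vertex between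
`u` and `v`. -/
theorem isSlide_insert {l₁ l₂ : List S} {u v q : S} {f : S → S}
    (h : IsLayout (l₁ ++ u :: v :: l₂) f) (hq : q ∉ l₁ ++ u :: v :: l₂) (hf : f q = u)
    (ht : EmptyTriangle S v u q) :
    IsSlide (layoutGraph (l₁ ++ u :: v :: l₂) f) (layoutGraph (l₁ ++ u :: q :: v :: l₂) f) := by
  have hqu : q ≠ u := by rintro rfl; simp at hq
  have hqv : q ≠ v := by rintro rfl; simp at hq
  have hn := notMem_otherEdges h hq (e := s(v, q)) (by simp)
  have hvu := h.spineEdge_notMem_otherEdges {q}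
  have huv : u ≠ v := by
    rintro rfl; exact absurd h.nodup (by simp [List.nodup_append])
  have e1 : s(v, q) ≠ s(v, u) := by simp [hqu, hqv]
  have e2 : s(u, q) ≠ s(v, u) := by simp [hqv, huv]
  have e3 : s(v, q) ≠ s(u, q) := by simp [huv.symm, hqv.symm]
  refine ⟨v, u, q, hqv.symm, ?_, ?_, ?_, ?_, ht⟩
  all_goals
    rw [h.edgeSet, layoutEdges_eq l₁ l₂ hq hf]
    try rw [(h.insert hq).edgeSet, layoutEdges_insert_eq]
  · exact Or.inr (Or.inl Sym2.eq_swap)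
  · rintro (he | he | he)
    · exact hn he
    · exact e1 (he.trans Sym2.eq_swap)
    · exact e3 he
  · ext e
    constructor
    · rintro (he | rfl | rfl)
      · exact Or.inl ⟨Or.inl he, by rintro rfl; exact hvu he⟩
      · exact Or.inl ⟨Or.inr (Or.inr rfl), e2⟩
      · exact Or.inr rfl
    · rintro (⟨he | rfl | rfl, hne⟩ | rfl)
      · exact Or.inl he
      · exact absurd Sym2.eq_swap hne
      · exact Or.inr (Or.inl rfl)
      · exact Or.inr (Or.inr rfl)
  · exact ⟨Or.inr (Or.inr rfl), Or.inr (Or.inl rfl)⟩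

theorem linked_insert (hS : GeneralPosition S) {l₁ l₂ : List S} {u v q : S} {f : S → S}
    (h : IsLayout (l₁ ++ u :: v :: l₂) f) (hq : q ∉ l₁ ++ u :: v :: l₂) (hf : f q = u)
    (ht : EmptyTriangle S v u q)
    (hfree : ∀ e ∈ otherEdges l₁ u v l₂ f {q},
      hull (e : Set S) ∩ hull (s(v, q) : Set S) ⊆ (S : Set Plane))
    (hT : Linked (layoutGraph (l₁ ++ u :: v :: l₂) f) (layoutGraph (l₁ ++ u :: v :: l₂) f)) :
    Linked (layoutGraph (l₁ ++ u :: v :: l₂) f) (layoutGraph (l₁ ++ u :: q :: v :: l₂) f) := by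
  refine hT.slide (h.insert hq) (isSlide_insert h hq hf ht)
    (hS.isPlane_of_subset_insert hT.isPlane (e₀ := s(v, q)) ?_ ?_)
  all_goals rw [(h.insert hq).edgeSet, layoutEdges_insert_eq]
  · rw [h.edgeSet, layoutEdges_eq l₁ l₂ hq hf]
    rintro e (he | rfl | rfl)
    · exact Or.inr (Or.inl he)
    · exact Or.inr (Or.inr (Or.inr rfl))
    · exact Or.inl rfl
  · rintro e (he | rfl | rfl) hne
    · exact hfree e he
    · exact hS.hull_inter_hull_subset_of_mem (x := q) hne (by simp) (by simp)
    · exact absurd rfl hne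

theorem linked_contract (hS : GeneralPosition S) {l₁ l₂ : List S} {u v q : S} {f : S → S}
    (h : IsLayout (l₁ ++ u :: v :: l₂) f) (hq : q ∉ l₁ ++ u :: v :: l₂) (hf : f q = u)
    (ht : EmptyTriangle S v u q)
    (hfree : ∀ e ∈ otherEdges l₁ u v l₂ f {q},
      hull (e : Set S) ∩ hull (s(u, v) : Set S) ⊆ (S : Set Plane))
    (hT : Linked (layoutGraph (l₁ ++ u :: q :: v :: l₂) f)
      (layoutGraph (l₁ ++ u :: q :: v :: l₂) f)) :
    Linked (layoutGraph (l₁ ++ u :: q :: v :: l₂) f) (layoutGraph (l₁ ++ u :: v :: l₂) f) := by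
  refine hT.slide h (isSlide_insert h hq hf ht).symm
    (hS.isPlane_of_subset_insert hT.isPlane (e₀ := s(u, v)) ?_ ?_)
  all_goals rw [h.edgeSet, layoutEdges_eq l₁ l₂ hq hf]
  · rw [(h.insert hq).edgeSet, layoutEdges_insert_eq]
    rintro e (he | rfl | rfl)
    · exact Or.inr (Or.inl he)
    · exact Or.inl rfl
    · exact Or.inr (Or.inr (Or.inl rfl))
  · rintro e (he | rfl | rfl) hne
    · exact hfree e he
    · exact absurd rfl hne
    · exact hS.hull_inter_hull_subset_of_mem (x := u) hne (by simp) (by simp)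

/-! ### Moving leaves along a spine edge -/

/-- The leaves `Z` at the spine vertex `u` lie on one side of the next spine edge `uv`, and nothing
else of the layout interferes with the hull of `u`, `v` and `Z`. -/
structure Movable (σ : ℝ) (l₁ : List S) (u v : S) (l₂ : List S) (f : S → S) (Z : Set S) :
    Prop where
  layout : IsLayout (l₁ ++ u :: v :: l₂) f
  off : ∀ z ∈ Z, z ∉ l₁ ++ u :: v :: l₂
  attached : ∀ z ∈ Z, f z = u
  side : ∀ z ∈ Z, 0 < σ * orient u v z
  closed : ∀ p : S, (p : Plane) ∈ hull (insert u (insert v Z)) → p ∈ insert u (insert v Z)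
  free : ∀ e ∈ otherEdges l₁ u v l₂ f Z,
    hull (e : Set S) ∩ hull (insert u (insert v Z)) ⊆ (S : Set Plane)

/-- The leaves of a movable configuration can be moved along the spine edge. -/
theorem Movable.linked (hS : GeneralPosition S) {Z : Set S} : ∀ {σ : ℝ} {l₁ : List S} {u v : S}
    {l₂ : List S} {f : S → S}, Movable σ l₁ u v l₂ f Z →
    Linked (layoutGraph (l₁ ++ u :: v :: l₂) f) (layoutGraph (l₁ ++ u :: v :: l₂) f) →
    Linked (layoutGraph (l₁ ++ u :: v :: l₂) f)
      (layoutGraph (l₁ ++ u :: v :: l₂) (reattach Z v f)) := by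
  -- Everything except `Z` is generalized: the inner calls use other spine edges, the reversed spine
  -- and the opposite orientation.
  induction Z using WellFoundedLT.induction with
  | ind Z ih =>
  intro σ l₁ u v l₂ f hM hT
  rcases Z.eq_empty_or_nonempty with rfl | hne
  · rwa [layoutGraph_congr (f := reattach ∅ v f) (g := f) fun x _ => reattach_of_notMem (by simp)]
  obtain ⟨q, hqZ, hqmin⟩ := hS.exists_min_angle hne σ u v hM.side
  have hqL := hM.off q hqZ
  have hqu : q ≠ u := by rintro rfl; simp at hqL
  have hqv : q ≠ v := by rintro rfl; simp at hqL
  have huZ : u ∉ Z := fun h => hM.off u h (by simp)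
  have hvZ : v ∉ Z := fun h => hM.off v h (by simp)
  have hq0 := hM.side q hqZ
  have hσ : σ ≠ 0 := by rintro rfl; simp at hq0
  have hquv : σ * orient q v u < 0 := by
    rw [orient_swap, orient_rotate]; linarith
  have huqv : σ * orient u q v < 0 := by
    rw [orient_swap, ← orient_rotate]; linarith
  -- The line `qv` splits the other leaves: `A` is separated from `u` by it, `B` lies on the side of
  -- `u`.
  set A : Set S := {z | z ∈ Z ∧ z ≠ q ∧ 0 < σ * orient q v z} with hA
  set B : Set S := {z | z ∈ Z ∧ z ≠ q ∧ σ * orient q v z < 0} with hB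
  have hAB : ∀ z ∈ Z, z ≠ q → z ∈ A ∨ z ∈ B := by
    intro z hz hzq
    have hzv : z ≠ v := by rintro rfl; exact hvZ hz
    rcases lt_or_gt_of_ne (mul_ne_zero hσ (hS.orient_ne_zero hqv hzq.symm hzv.symm)) with h | h
    · exact Or.inr ⟨hz, hzq, h⟩
    · exact Or.inl ⟨hz, hzq, h⟩
  have hAnB : ∀ z ∈ A, z ∉ B := fun z h h' => lt_asymm h.2.2 h'.2.2
  have hAlt : A < Z := ⟨fun z h => h.1, fun h => (h hqZ).2.1 rfl⟩
  have hBlt : B < Z := ⟨fun z h => h.1, fun h => (h hqZ).2.1 rfl⟩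
  have hqlt : Z \ {q} < Z := ⟨fun z h => h.1, fun h => (h hqZ).2 rfl⟩
  have hfree : ∀ e ∈ otherEdges l₁ u v l₂ f Z, ∀ Y ⊆ insert u (insert v Z),
      hull (e : Set S) ∩ hull Y ⊆ (S : Set Plane) := fun e he Y hY =>
    (Set.inter_subset_inter_right _ (hull_mono hY)).trans (hM.free e he)
  have hclosed : ∀ Y ⊆ insert u (insert v Z), ∀ p : S, (p : Plane) ∈ hull Y →
      p ∈ insert u (insert v Z) := fun Y hY p hp => hM.closed p (hull_mono hY hp)
  have htri : EmptyTriangle S v u q := by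
    intro p hp hpt
    lift p to S using hp
    have hpt' : (p : Plane) ∈ hull {v, u, q} := by
      rw [hull]; convert hpt using 2; simp [Set.image_insert_eq]
    rcases hclosed {v, u, q} (by rintro z (rfl | rfl | rfl) <;> simp [hqZ]) p hpt' with h | h | h
    · exact Or.inr (Or.inl (congrArg _ h))
    · exact Or.inl (congrArg _ h)
    · by_contra! hcon
      -- The triangle `vuq` lies on the side of `uq` containing `v`, all other points of `Z`
      -- strictly on the opposite side.
      have h1 := hqmin p h (by rintro rfl; exact hcon.2.2 rfl)
      have h2 := orient_nonneg_of_mem_hull (σ := -σ) (a := u) (b := q) hpt' (by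
        rintro z (rfl | rfl | rfl)
        · linarith
        · simp [orient_self_left]
        · simp [orient_self_right])
      linarith
  have hL' := hM.layout.insert hqL
  -- insert `q` into the spine
  have s₁ := linked_insert hS hM.layout hqL (hM.attached q hqZ) htri (by
    rintro e (he | ⟨x, hx, hxq, rfl⟩)
    · exact hfree e (Or.inl he) _ (by
        intro z hz; rcases Sym2.mem_iff.1 hz with rfl | rfl <;> simp [hqZ])
    · by_cases hxZ : x ∈ Z
      · rw [Set.inter_comm, hM.attached x hxZ]
        -- The line `uq` separates the new edge `vq` from the leaf edges of `Z \ {q}` at `u`.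
        refine hull_inter_hull_subset (-σ) u q q (orient_self_right _ _) ?_ ?_
        · intro z hz
          rcases Sym2.mem_iff.1 hz with rfl | rfl
          · right; linarith
          · exact Or.inl rfl
        · intro z hz
          rcases Sym2.mem_iff.1 hz with rfl | rfl
          · have := hqmin z hxZ hxq; linarith
          · simp [orient_self_left]
      · exact hfree _ (Or.inr ⟨x, hx, hxZ, rfl⟩) _ (by
          intro z hz; rcases Sym2.mem_iff.1 hz with rfl | rfl <;> simp [hqZ])) hT
  -- move all other leaves from `u` to `q`
  have hsub₂ : insert u (insert q (Z \ {q})) ⊆ insert u (insert v Z) :=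
    Set.insert_subset (by simp) (Set.insert_subset (by simp [hqZ]) fun z hz => by simp [hz.1])
  have s₂ := ih _ hqlt (σ := σ) (l₁ := l₁) (u := u) (v := q) (l₂ := v :: l₂) (f := f)
    { layout := hL'
      off := fun z hz => by
        have := hM.off z hz.1
        have hzq : z ≠ q := hz.2
        simp at this ⊢; tauto
      attached := fun z hz => hM.attached z hz.1
      side := fun z hz => hqmin z hz.1 hz.2
      closed := fun p hp => by
        have hpY := hclosed _ hsub₂ p hp
        have h0 := orient_nonneg_of_mem_hull (σ := σ) (a := u) (b := q) hp (by
          rintro z (rfl | rfl | hz)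
          · simp [orient_self_left]
          · simp [orient_self_right]
          · exact (hqmin z hz.1 hz.2).le)
        rcases hpY with rfl | rfl | h
        · simp
        · linarith
        · by_cases hpq : p = q
          · simp [hpq]
          · exact Or.inr (Or.inr ⟨h, hpq⟩)
      free := by
        rintro e ((he | rfl | he) | ⟨x, hx, hxZ, rfl⟩)
        · exact hfree e (Or.inl (Or.inl he)) _ hsub₂
        · refine hull_inter_hull_subset (-σ) u q q (orient_self_right _ _) ?_ ?_
          · intro z hz
            rcases Sym2.mem_iff.1 hz with rfl | rfl
            · exact Or.inl rfl
            · right; linarith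
          · rintro z (rfl | rfl | hz)
            · simp [orient_self_left]
            · simp [orient_self_right]
            · have := hqmin z hz.1 hz.2; linarith
        · exact hfree e (Or.inl (Or.inr he)) _ hsub₂
        · refine hfree _ (Or.inr ⟨x, ?_, fun h => hxZ ⟨h, ?_⟩, rfl⟩) _ hsub₂
          · simp at hx ⊢; tauto
          · rintro rfl; simp at hx } s₁.right
  -- move `A` from `q` to `v`
  set f₂ := reattach (Z \ {q}) q f with hf₂
  have hL₂ : IsLayout (l₁ ++ u :: q :: v :: l₂) f₂ := hL'.reattach (by simp) _
  have hl₃ : (l₁ ++ [u]) ++ q :: v :: l₂ = l₁ ++ u :: q :: v :: l₂ := by simp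
  have hoff : ∀ z ∈ Z, z ≠ q → z ∉ l₁ ++ u :: q :: v :: l₂ := fun z hz hzq => by
    have := hM.off z hz
    simp at this ⊢; tauto
  have hsub₃ : insert q (insert v A) ⊆ insert u (insert v Z) :=
    Set.insert_subset (by simp [hqZ]) (Set.insert_subset (by simp) fun z hz => by simp [hz.1])
  have hnotL : ∀ x, x ∉ l₁ ++ u :: q :: v :: l₂ → x ∉ l₁ ++ u :: v :: l₂ ∧ x ≠ q := by
    intro x hx
    simp at hx ⊢; tauto
  have s₃ := ih _ hAlt (σ := σ) (l₁ := l₁ ++ [u]) (u := q) (v := v) (l₂ := l₂) (f := f₂)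
    { layout := by rwa [hl₃]
      off := fun z hz => by rw [hl₃]; exact hoff z hz.1 hz.2.1
      attached := fun z hz => reattach_of_mem ⟨hz.1, hz.2.1⟩
      side := fun z hz => hz.2.2
      closed := fun p hp => by
        have hpY := hclosed _ hsub₃ p hp
        have h0 := orient_nonneg_of_mem_hull (σ := σ) (a := q) (b := v) hp (by
          rintro z (rfl | rfl | hz)
          · simp [orient_self_left]
          · simp [orient_self_right]
          · exact hz.2.2.le)
        rcases hpY with rfl | rfl | h
        · linarith
        · simp
        · by_cases hpq : p = q
          · simp [hpq]
          · rcases hAB p h hpq with h' | h'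
            · exact Or.inr (Or.inr h')
            · exact absurd h'.2.2 (not_lt.2 h0)
      free := by
        -- The edges at `q` towards the side of `u`, namely `uq` and those of `B`, stay on the far
        -- side of the line `qv` from `A`.
        have key : ∀ b : S, σ * orient q v b < 0 →
            hull (s(b, q) : Set S) ∩ hull (insert q (insert v A)) ⊆ (S : Set Plane) := by
          intro b hb
          refine hull_inter_hull_subset (-σ) q v q (orient_self_left _ _) ?_ ?_
          · intro z hz
            rcases Sym2.mem_iff.1 hz with rfl | rfl
            · right; linarith
            · exact Or.inl rfl
          · rintro z (rfl | rfl | hz)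
            · simp [orient_self_left]
            · simp [orient_self_right]
            · have := hz.2.2; linarith
        rintro e ((he | he) | ⟨x, hx, hxA, rfl⟩)
        · rw [List.append_assoc, List.singleton_append, pathEdges_append_cons] at he
          rcases he with he | rfl | he
          · exact hfree e (Or.inl (Or.inl he)) _ hsub₃
          · exact key u hquv
          · exact he.elim
        · exact hfree e (Or.inl (Or.inr he)) _ hsub₃
        · rw [hl₃] at hx
          obtain ⟨hxL, hxq⟩ := hnotL x hx
          by_cases hxZ : x ∈ Z
          · rw [hf₂, reattach_of_mem (show x ∈ Z \ {q} from ⟨hxZ, hxq⟩)]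
            exact key x ((hAB x hxZ hxq).resolve_left hxA).2.2
          · rw [hf₂, reattach_of_notMem fun h => hxZ h.1]
            exact hfree _ (Or.inr ⟨x, hxL, hxZ, rfl⟩) _ hsub₃ } (by rw [hl₃]; exact s₂.right)
  rw [hl₃] at s₃
  -- move `B` from `q` back to `u`
  set f₃ := reattach A v f₂ with hf₃
  have hL₃ : IsLayout (l₁ ++ u :: q :: v :: l₂) f₃ := hL₂.reattach (by simp) _
  have hl₄ : (v :: l₂).reverse ++ q :: u :: l₁.reverse =
      (l₁ ++ u :: q :: v :: l₂).reverse := by simp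
  have hsub₄ : insert q (insert u B) ⊆ insert u (insert v Z) :=
    Set.insert_subset (by simp [hqZ]) (Set.insert_subset (by simp) fun z hz => by simp [hz.1])
  -- For `b ∈ B` the ray `qu` runs between `qv` and `qb`, so a direct move along `qv` is obstructed
  -- by the edge `uq`. In the reversed spine `u` follows `q`, and the sign of `σ` flips with the
  -- direction of the edge.
  have s₄ := ih _ hBlt (σ := -σ) (l₁ := (v :: l₂).reverse) (u := q) (v := u) (l₂ := l₁.reverse)
    (f := f₃)
    { layout := by rw [hl₄]; exact hL₃.reverse
      off := fun z hz => by
        rw [hl₄, List.mem_reverse]; exact hoff z hz.1 hz.2.1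
      attached := fun z hz => by
        rw [hf₃, reattach_of_notMem fun h => hAnB z h hz]
        exact reattach_of_mem ⟨hz.1, hz.2.1⟩
      side := fun z hz => by
        have := hqmin z hz.1 hz.2.1
        rw [orient_swap]; linarith
      closed := fun p hp => by
        have hpY := hclosed _ hsub₄ p hp
        have h0 := orient_nonneg_of_mem_hull (σ := σ) (a := u) (b := q) hp (by
          rintro z (rfl | rfl | hz)
          · simp [orient_self_right]
          · simp [orient_self_left]
          · exact (hqmin z hz.1 hz.2.1).le)
        have h1 := orient_nonneg_of_mem_hull (σ := -σ) (a := q) (b := v) hp (by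
          rintro z (rfl | rfl | hz)
          · simp [orient_self_left]
          · linarith
          · have := hz.2.2; linarith)
        rcases hpY with rfl | rfl | h
        · simp
        · linarith
        · by_cases hpq : p = q
          · simp [hpq]
          · rcases hAB p h hpq with h' | h'
            · have := h'.2.2; linarith
            · exact Or.inr (Or.inr h')
      free := by
        rw [otherEdges_reverse]
        rintro e ((he | rfl | he) | ⟨x, hx, hxB, rfl⟩)
        · exact hfree e (Or.inl (Or.inl he)) _ hsub₄
        · rw [Set.inter_comm]
          refine hull_inter_hull_subset (-σ) q v q (orient_self_left _ _) ?_ ?_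
          · rintro z (rfl | rfl | hz)
            · exact Or.inl rfl
            · right; linarith
            · have := hz.2.2; right; linarith
          · intro z hz
            rcases Sym2.mem_iff.1 hz with rfl | rfl
            · simp [orient_self_left]
            · simp [orient_self_right]
        · exact hfree e (Or.inl (Or.inr he)) _ hsub₄
        · obtain ⟨hxL, hxq⟩ := hnotL x hx
          by_cases hxZ : x ∈ Z
          · have hxA := (hAB x hxZ hxq).resolve_right hxB
            rw [hf₃, reattach_of_mem hxA]
            refine hull_inter_hull_subset σ q v v (orient_self_right _ _) ?_ ?_
            · intro z hz
              rcases Sym2.mem_iff.1 hz with rfl | rfl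
              · exact Or.inr hxA.2.2
              · exact Or.inl rfl
            · rintro z (rfl | rfl | hz)
              · simp [orient_self_left]
              · exact hquv.le
              · exact hz.2.2.le
          · rw [hf₃, reattach_of_notMem fun h => hxZ h.1, hf₂,
              reattach_of_notMem fun h => hxZ h.1]
            exact hfree _ (Or.inr ⟨x, hxL, hxZ, rfl⟩) _ hsub₄ }
    (by rw [hl₄, layoutGraph_reverse]; exact s₃.right)
  rw [hl₄, layoutGraph_reverse, layoutGraph_reverse] at s₄
  -- take `q` out of the spine, as a leaf at `v`
  set f₅ := reattach {q} v (reattach B u f₃) with hf₅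
  have hf₅q : f₅ q = v := reattach_of_mem rfl
  have hf₅A : ∀ x ∈ A, f₅ x = v := fun x hx => by
    rw [hf₅, reattach_of_notMem (show x ∉ ({q} : Set S) from hx.2.1), reattach_of_notMem (hAnB x hx), hf₃,
      reattach_of_mem hx]
  have hf₅B : ∀ x ∈ B, f₅ x = u := fun x hx => by
    rw [hf₅, reattach_of_notMem (show x ∉ ({q} : Set S) from hx.2.1), reattach_of_mem hx]
  have hf₅Z : ∀ x, x ∉ Z → f₅ x = f x := fun x hx => by
    rw [hf₅, reattach_of_notMem (by rintro rfl; exact hx hqZ), reattach_of_notMem fun h => hx h.1,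
      hf₃, reattach_of_notMem fun h => hx h.1, hf₂, reattach_of_notMem fun h => hx h.1]
  have hL₅ : IsLayout (l₁ ++ u :: v :: l₂) f₅ := by
    refine ⟨hM.layout.nodup, fun x hx => ?_⟩
    by_cases hxZ : x ∈ Z
    · by_cases hxq : x = q
      · rw [hxq, hf₅q]; simp
      · rcases hAB x hxZ hxq with h | h
        · rw [hf₅A x h]; simp
        · rw [hf₅B x h]; simp
    · rw [hf₅Z x hxZ]; exact hM.layout.maps x hx
  have hl₅ : l₂.reverse ++ v :: u :: l₁.reverse = (l₁ ++ u :: v :: l₂).reverse := by simp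
  have hl₅' : l₂.reverse ++ v :: q :: u :: l₁.reverse = (l₁ ++ u :: q :: v :: l₂).reverse := by
    simp
  -- While `q` is on the spine, setting `f₅ q = v` does not change the graph.
  have hg₅ : layoutGraph (l₁ ++ u :: q :: v :: l₂) (reattach B u f₃) =
      layoutGraph (l₁ ++ u :: q :: v :: l₂) f₅ := layoutGraph_congr fun x hx =>
    (reattach_of_notMem (show x ∉ ({q} : Set S) from (hnotL x hx).2)).symm
  rw [hg₅] at s₄
  -- The edges of the leaves in `Z \ {q}` now end at `u` or `v`, so they share an endpoint with the
  -- new edge `uv` and cannot cross it.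
  have s₅ := linked_contract hS (l₁ := l₂.reverse) (l₂ := l₁.reverse) (u := v) (v := u) (q := q)
    (f := f₅) (by rw [hl₅]; exact hL₅.reverse) (by rw [hl₅, List.mem_reverse]; exact hqL) hf₅q
    (fun p hp h => by
      have := htri p hp (by rwa [Set.insert_comm])
      tauto) (by
    rw [otherEdges_reverse]
    have hsub : ((s(v, u) : Sym2 S) : Set S) ⊆ insert u (insert v Z) := by
      intro z hz; rcases Sym2.mem_iff.1 hz with rfl | rfl <;> simp
    rintro e (he | ⟨x, hx, hxq, rfl⟩)
    · exact hfree e (Or.inl he) _ hsub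
    · by_cases hxZ : x ∈ Z
      · have hne : ∀ y, s(x, y) ≠ s(v, u) := by
          intro y h
          have : x ∈ s(v, u) := h ▸ Sym2.mem_mk_left _ _
          rcases Sym2.mem_iff.1 this with rfl | rfl
          · exact hvZ hxZ
          · exact huZ hxZ
        rcases hAB x hxZ hxq with h | h
        · rw [hf₅A x h]
          exact hS.hull_inter_hull_subset_of_mem (x := v) (hne v) (by simp) (by simp)
        · rw [hf₅B x h]
          exact hS.hull_inter_hull_subset_of_mem (x := u) (hne u) (by simp) (by simp)
      · rw [hf₅Z x hxZ]
        exact hfree _ (Or.inr ⟨x, hx, hxZ, rfl⟩) _ hsub)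
    (by rw [hl₅', layoutGraph_reverse]; exact s₄.right)
  rw [hl₅, hl₅', layoutGraph_reverse, layoutGraph_reverse] at s₅
  -- move `B` from `u` to `v`
  have hsub₆ : insert u (insert v B) ⊆ insert u (insert v Z) :=
    Set.insert_subset_insert (Set.insert_subset_insert fun z hz => hz.1)
  -- The hull of `u`, `v`, `B` touches the line `qv` only at `v`, while the edges from `v` to `q`
  -- and to `A` lie on that line or beyond it.
  have hside₆ : ∀ z ∈ insert u (insert v B), z = v ∨ 0 < -σ * orient q v z := by
    rintro z (rfl | rfl | hz)
    · right; linarith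
    · exact Or.inl rfl
    · have := hz.2.2; right; linarith
  have s₆ := ih _ hBlt (σ := σ) (l₁ := l₁) (u := u) (v := v) (l₂ := l₂) (f := f₅)
    { layout := hL₅
      off := fun z hz => hM.off z hz.1
      attached := hf₅B
      side := fun z hz => hM.side z hz.1
      closed := fun p hp => by
        rcases hclosed _ hsub₆ p hp with rfl | rfl | h
        · simp
        · simp
        · have h0 := hull_subset (convex_eq_or_orient_lt (-σ) q v v) (fun x hx => by
            rcases hside₆ x hx with rfl | h
            · exact Or.inl rfl
            · right; rw [orient_self_right]; linarith) hp
          rcases h0 with h0 | h0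
          · exact absurd (Subtype.ext h0 ▸ h) hvZ
          · rw [orient_self_right] at h0
            by_cases hpq : p = q
            · rw [hpq, orient_self_left] at h0; linarith
            · rcases hAB p h hpq with h' | h'
              · have := h'.2.2; linarith
              · exact Or.inr (Or.inr h')
      free := by
        have key : ∀ x : S, 0 ≤ σ * orient q v x →
            hull (s(x, v) : Set S) ∩ hull (insert u (insert v B)) ⊆ (S : Set Plane) := by
          intro x hx
          rw [Set.inter_comm]
          refine hull_inter_hull_subset (-σ) q v v (orient_self_right _ _) hside₆ ?_
          intro z hz
          rcases Sym2.mem_iff.1 hz with rfl | rfl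
          · linarith
          · simp [orient_self_right]
        rintro e (he | ⟨x, hx, hxB, rfl⟩)
        · exact hfree e (Or.inl he) _ hsub₆
        · by_cases hxZ : x ∈ Z
          · by_cases hxq : x = q
            · rw [hxq, hf₅q]; exact key q (by simp [orient_self_left])
            · have hxA := (hAB x hxZ hxq).resolve_right hxB
              rw [hf₅A x hxA]; exact key x hxA.2.2.le
          · rw [hf₅Z x hxZ]
            exact hfree _ (Or.inr ⟨x, hx, hxZ, rfl⟩) _ hsub₆ } s₅.right
  have hfin : layoutGraph (l₁ ++ u :: v :: l₂) (reattach B v f₅) =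
      layoutGraph (l₁ ++ u :: v :: l₂) (reattach Z v f) := by
    refine layoutGraph_congr fun x _ => ?_
    by_cases hxZ : x ∈ Z
    · rw [reattach_of_mem hxZ]
      by_cases hxB : x ∈ B
      · exact reattach_of_mem hxB
      · rw [reattach_of_notMem hxB]
        by_cases hxq : x = q
        · rw [hxq, hf₅q]
        · exact hf₅A x ((hAB x hxZ hxq).resolve_right hxB)
    · rw [reattach_of_notMem hxZ, reattach_of_notMem fun h => hxZ h.1, hf₅Z x hxZ]
  rw [hfin] at s₆
  exact ((((s₁.trans s₂).trans s₃).trans s₄).trans s₅).trans s₆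

/-! ### Barycentric coordinates in a triangle -/

theorem convex_orient_lt (σ c : ℝ) (a b : Plane) :
    Convex ℝ {x : Plane | σ * orient a b x < c} := by
  intro x hx y hy s t hs ht hst
  simp only [Set.mem_ofPred_eq] at *
  rw [orient_combo _ _ _ _ hst]
  obtain rfl : t = 1 - s := by linarith
  rcases hs.eq_or_lt with rfl | hs
  · linarith
  · nlinarith

/-- Cramer's rule: the areas of the three subtriangles at `x` are its unnormalized barycentric
coordinates with respect to `u`, `v`, `a`. -/
theorem orient_smul_eq (u v a x : Plane) :
    orient u v a • x = orient v a x • u + orient a u x • v + orient u v x • a := by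
  ext i
  fin_cases i <;> simp [orient] <;> ring

theorem orient_add_add (u v a x : Plane) :
    orient v a x + orient a u x + orient u v x = orient u v a := by
  unfold orient; ring

theorem mem_hull_triangle {u v a : S} {σ : ℝ} {x : Plane} (hD : 0 < σ * orient u v a)
    (h1 : 0 ≤ σ * orient u v x) (h2 : 0 ≤ σ * orient v a x) (h3 : 0 ≤ σ * orient a u x) :
    x ∈ hull {u, v, a} := by
  set D := σ * orient u v a
  have hx : x = (σ * orient v a x / D) • (u : Plane) + (σ * orient a u x / D) • (v : Plane) +
      (σ * orient u v x / D) • (a : Plane) := by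
    have h := congrArg (fun y => (σ / D) • y) (orient_smul_eq u v a x)
    simp only [smul_add, smul_smul] at h
    have h' : σ / D * orient u v a = 1 := by
      rw [div_mul_eq_mul_div]; exact div_self hD.ne'
    rw [h', one_smul] at h
    simpa only [div_mul_eq_mul_div] using h
  have hsum : σ * orient v a x / D + σ * orient a u x / D + σ * orient u v x / D = 1 := by
    rw [← add_div, ← add_div, ← mul_add, ← mul_add, orient_add_add]
    exact div_self hD.ne'
  have hmem := (convex_convexHull ℝ (((↑) : S → Plane) '' {u, v, a})).sum_mem
    (t := Finset.univ) (w := ![σ * orient v a x / D, σ * orient a u x / D, σ * orient u v x / D])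
    (z := ![(u : Plane), (v : Plane), (a : Plane)])
    (by intro i _; fin_cases i <;> simp <;> positivity)
    (by simpa [Fin.sum_univ_three] using hsum)
    (by
      intro i _
      fin_cases i
      · exact mem_hull (Y := {u, v, a}) (x := u) (by simp)
      · exact mem_hull (Y := {u, v, a}) (x := v) (by simp)
      · exact mem_hull (Y := {u, v, a}) (x := a) (by simp))
  rw [Fin.sum_univ_three] at hmem
  rw [hx]
  exact hmem

theorem mem_segment_of_orient {u v a x : Plane} {σ : ℝ} (hD : 0 < σ * orient u v a)
    (h1 : 0 ≤ σ * orient u v x) (h2 : σ * orient v a x = 0) (h3 : 0 ≤ σ * orient a u x) :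
    x ∈ segment ℝ v a := by
  set D := σ * orient u v a
  refine ⟨σ * orient a u x / D, σ * orient u v x / D, by positivity, by positivity, ?_, ?_⟩
  · rw [← add_div, div_eq_one_iff_eq hD.ne']
    have := congrArg (σ * ·) (orient_add_add u v a x)
    simp only [mul_add] at this
    linarith
  · have h := congrArg (fun y => (σ / D) • y) (orient_smul_eq u v a x)
    simp only [smul_add, smul_smul, div_mul_eq_mul_div] at h
    rw [div_self hD.ne', one_smul, h2] at h
    simpa using h.symm

/-- A segment from the corner `u` of a triangle `uva` that meets the triangle in a further point
either ends in the triangle or crosses `va`. -/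
theorem mem_triangle_or_crosses {u v a x : S} {σ : ℝ} (hD : 0 < σ * orient u v a) {y : Plane}
    (hy : y ∈ segment ℝ (x : Plane) u) (hyu : y ≠ u) (hyK : y ∈ hull {u, v, a}) :
    (x : Plane) ∈ hull {u, v, a} ∨
      (segment ℝ (x : Plane) u ∩ segment ℝ (v : Plane) a).Nonempty := by
  obtain ⟨s, t, hs, ht, hst, rfl⟩ := hy
  have hs' : 0 < s := by
    refine lt_of_le_of_ne hs ?_
    rintro rfl
    exact hyu (by simp [show t = 1 by linarith])
  have hu2 : σ * orient v a u = σ * orient u v a := by rw [orient_rotate]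
  have hv3 : σ * orient a u v = σ * orient u v a := by rw [← orient_rotate]
  have g1 := orient_nonneg_of_mem_hull (σ := σ) (a := u) (b := v) hyK (by
    rintro z (rfl | rfl | rfl)
    · simp [orient_self_left]
    · simp [orient_self_right]
    · exact hD.le)
  have g3 := orient_nonneg_of_mem_hull (σ := σ) (a := a) (b := u) hyK (by
    rintro z (rfl | rfl | rfl)
    · simp [orient_self_right]
    · linarith
    · simp [orient_self_left])
  rw [orient_combo _ _ _ _ hst, orient_self_left] at g1
  rw [orient_combo _ _ _ _ hst, orient_self_right] at g3
  have g1' : 0 ≤ σ * orient u v x := by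
    by_contra! h; nlinarith
  have g3' : 0 ≤ σ * orient a u x := by
    by_contra! h; nlinarith
  by_cases g2 : 0 ≤ σ * orient v a x
  · exact Or.inl (mem_hull_triangle hD g1' g2 g3')
  push Not at g2
  right
  set D := σ * orient u v a
  set g := σ * orient v a x
  have hDg : 0 < D - g := by linarith
  have hr : D / (D - g) + -g / (D - g) = 1 := by
    rw [← add_div, div_eq_one_iff_eq hDg.ne']; ring
  have hr0 : 0 ≤ D / (D - g) := by positivity
  have hr1 : 0 ≤ -g / (D - g) := div_nonneg (by linarith) hDg.le
  -- The affine function `σ * orient v a` equals `g < 0` at `x` and `D > 0` at `u`; these weights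
  -- give its zero on the segment, the crossing with `va`.
  refine ⟨(D / (D - g)) • (x : Plane) + (-g / (D - g)) • (u : Plane),
    ⟨_, _, hr0, hr1, hr, rfl⟩, mem_segment_of_orient hD ?_ ?_ ?_⟩
  · rw [orient_combo _ _ _ _ hr, orient_self_left]
    nlinarith [mul_nonneg hr0 g1']
  · rw [orient_combo _ _ _ _ hr]
    have : σ * (D / (D - g) * orient v a x + -g / (D - g) * orient v a u) =
      D / (D - g) * g + -g / (D - g) * (σ * orient v a u) := by ring
    rw [this, hu2]; ring
  · rw [orient_combo _ _ _ _ hr, orient_self_right]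
    nlinarith [mul_nonneg hr0 g3']

/-! ### From a double star to a star -/

/-- Induction on the set `W` of leaves of `v`: each round returns one leaf `a` to `u`. The points of
`S` inside the triangle `uva` first have to join `a` at `v`, since a movable set must contain every
further point of its hull. -/
theorem linked_star (hS : GeneralPosition S) {u v : S} (huv : u ≠ v) {W : Set S} :
    ∀ {f : S → S}, W = {x | x ≠ u ∧ x ≠ v ∧ f x = v} → IsLayout [u, v] f →
      Linked (layoutGraph [u, v] f) (layoutGraph [u, v] f) →
      Linked (layoutGraph [u, v] f) (layoutGraph [u, v] fun _ => u) := by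
  induction W using WellFoundedLT.induction with
  | ind W ih =>
  intro f hW hL hT
  have hf : ∀ x, x ≠ u → x ≠ v → f x = u ∨ f x = v := fun x hu hv => by
    simpa using hL.maps x (by simp [hu, hv])
  rcases W.eq_empty_or_nonempty with rfl | ⟨a₀, ha₀⟩
  · rwa [layoutGraph_congr (f := fun _ => u) (g := f)]
    intro x hx
    simp only [List.mem_cons, List.not_mem_nil, or_false, not_or] at hx
    refine ((hf x hx.1 hx.2).resolve_right fun h => ?_).symm
    have : x ∈ (∅ : Set S) := hW ▸ ⟨hx.1, hx.2, h⟩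
    exact this
  -- Only the sign of `σ` matters; taking the signed area of `a₀` itself makes the product a square.
  obtain ⟨σ, hσ₀⟩ : ∃ σ : ℝ, 0 < σ * orient u v a₀ := by
    rw [hW] at ha₀
    exact ⟨orient u v a₀, mul_self_pos.2 (hS.orient_ne_zero huv ha₀.1.symm ha₀.2.1.symm)⟩
  -- Angles are now measured at `v` from the ray `vu`, which reverses the orientation.
  obtain ⟨a, ⟨haW, hD⟩, hmin⟩ := hS.exists_min_angle
    (Z := {b | b ∈ W ∧ 0 < σ * orient u v b}) ⟨a₀, ha₀, hσ₀⟩ (-σ) v u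
    (fun z hz => by have := hz.2; rw [orient_swap]; linarith)
  obtain ⟨hau, hav, hfa⟩ : a ≠ u ∧ a ≠ v ∧ f a = v := by rw [hW] at haW; exact haW
  have hσ : σ ≠ 0 := by rintro rfl; simp at hD
  have hu2 : σ * orient v a u = σ * orient u v a := by rw [orient_rotate]
  set K : Set Plane := hull {u, v, a} with hK
  have hK1 : ∀ x ∈ K, 0 ≤ σ * orient u v x := fun x hx => orient_nonneg_of_mem_hull hx (by
    rintro z (rfl | rfl | rfl)
    · simp [orient_self_left]
    · simp [orient_self_right]
    · exact hD.le)
  have hK2 : ∀ x ∈ K, 0 ≤ σ * orient v a x := fun x hx => orient_nonneg_of_mem_hull hx (by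
    rintro z (rfl | rfl | rfl)
    · linarith
    · simp [orient_self_left]
    · simp [orient_self_right])
  have hside : ∀ x : S, x ≠ u → x ≠ v → 0 ≤ σ * orient u v x → 0 < σ * orient u v x :=
    fun x hxu hxv h =>
      lt_of_le_of_ne h (mul_ne_zero hσ (hS.orient_ne_zero huv hxu.symm hxv.symm)).symm
  have hW2 : ∀ x : S, x ≠ u → x ≠ v → x ≠ a → f x = v → 0 ≤ σ * orient u v x →
      σ * orient v a x < 0 := by
    intro x hxu hxv hxa hfx hx
    have := hmin x ⟨hW ▸ ⟨hxu, hxv, hfx⟩, hside x hxu hxv hx⟩ hxa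
    linarith
  -- edges that do not end in the triangle `uva` avoid it
  have hout : ∀ x : S, (x : Plane) ∉ K → hull (s(x, f x) : Set S) ∩ K ⊆ (S : Set Plane) := by
    intro x hx y hy
    have hxu : x ≠ u := by rintro rfl; exact hx (mem_hull (by simp))
    have hxv : x ≠ v := by rintro rfl; exact hx (mem_hull (by simp))
    have hxa : x ≠ a := by rintro rfl; exact hx (mem_hull (by simp))
    rw [hull_sym2] at hy
    rcases hf x hxu hxv with hfx | hfx
    · rw [hfx] at hy
      by_cases hyu : y = u
      · exact hyu ▸ u.2
      rcases mem_triangle_or_crosses hD hy.1 hyu hy.2 with h | ⟨z, hz⟩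
      · exact absurd h hx
      -- The edges `xu` and `va` would cross, yet they have no common endpoint.
      · have hp := hT.isPlane x u v a (hL.adj_iff.2 (Or.inr ⟨x, by simp [hxu, hxv], by rw [hfx]⟩))
          (hL.adj_iff.2 (Or.inr ⟨a, by simp [hau, hav], by rw [hfa]; exact Sym2.eq_swap⟩))
          (by simp [hxv, hxa]) hz
        rcases hp with ⟨rfl | rfl, h | h⟩
        · exact absurd (Subtype.ext h) hxv
        · exact absurd (Subtype.ext h) hxa
        · exact absurd (Subtype.ext h) huv
        · exact absurd (Subtype.ext h).symm hau
    · rw [hfx] at hy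
      obtain ⟨⟨s, t, hs, ht, hst, rfl⟩, hyK⟩ := hy
      rcases hs.eq_or_lt with rfl | hs
      · simp [show t = 1 by linarith]
      exfalso
      have g1 := hK1 _ hyK
      have g2 := hK2 _ hyK
      rw [orient_combo _ _ _ _ hst, orient_self_right] at g1
      rw [orient_combo _ _ _ _ hst, orient_self_left] at g2
      have g1' : 0 ≤ σ * orient u v x := by
        by_contra! h; nlinarith
      have := hW2 x hxu hxv hxa hfx g1'
      nlinarith
  set Q : Set S := {x | x ≠ u ∧ x ≠ v ∧ x ≠ a ∧ (x : Plane) ∈ K} with hQ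
  have hmemK : ∀ x : S, (x : Plane) ∈ K → x = u ∨ x = v ∨ x = a ∨ x ∈ Q := by
    intro x hx
    by_cases h1 : x = u
    · exact Or.inl h1
    by_cases h2 : x = v
    · exact Or.inr (Or.inl h2)
    by_cases h3 : x = a
    · exact Or.inr (Or.inr (Or.inl h3))
    exact Or.inr (Or.inr (Or.inr ⟨h1, h2, h3, hx⟩))
  -- A leaf of `v` in the triangle would be angularly closer to `vu` than `a`.
  have hfQ : ∀ x ∈ Q, f x = u := fun x hx => (hf x hx.1 hx.2.1).resolve_right fun h =>
    absurd (hW2 x hx.1 hx.2.1 hx.2.2.1 h (hK1 x hx.2.2.2)) (not_lt.2 (hK2 x hx.2.2.2))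
  have hsub₁ : hull (insert u (insert v Q)) ⊆ K := hull_subset (convex_convexHull ℝ _) (by
    rintro z (rfl | rfl | hz)
    · exact mem_hull (by simp)
    · exact mem_hull (by simp)
    · exact hz.2.2.2)
  have hsub₂ : hull (insert v (insert u (insert a Q))) ⊆ K :=
    hull_subset (convex_convexHull ℝ _) (by
      rintro z (rfl | rfl | rfl | hz)
      · exact mem_hull (by simp)
      · exact mem_hull (by simp)
      · exact mem_hull (by simp)
      · exact hz.2.2.2)
  have m₁ : Movable σ [] u v [] f Q :=
    { layout := hL
      off := fun z hz => by simp [hz.1, hz.2.1]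
      attached := hfQ
      side := fun z hz => hside z hz.1 hz.2.1 (hK1 z hz.2.2.2)
      closed := fun p hp => by
        -- Within the triangle `a` is the unique point farthest from the line `uv`, so the hull of
        -- `u`, `v`, `Q` misses it.
        have hlt := hull_subset (convex_orient_lt σ (σ * orient u v a) u v) (by
          rintro z (rfl | rfl | hz)
          · simpa [orient_self_left] using hD
          · simpa [orient_self_right] using hD
          · have h := hull_subset (convex_eq_or_orient_lt (-σ) u v a) (by
              rintro w (rfl | rfl | rfl)
              · right; rw [orient_self_left]; linarith
              · right; rw [orient_self_right]; linarith
              · exact Or.inl rfl) hz.2.2.2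
            rcases h with h | h
            · exact absurd (Subtype.ext h) hz.2.2.1
            · have h' : -σ * orient u v a < -σ * orient u v z := h
              change σ * orient u v z < σ * orient u v a
              linarith) hp
        rcases hmemK p (hsub₁ hp) with h | h | rfl | h
        · simp [h]
        · simp [h]
        · exact (lt_irrefl (σ * orient u v p) hlt).elim
        · exact Or.inr (Or.inr h)
      free := by
        rintro e ((he | he) | ⟨x, hx, hxQ, rfl⟩)
        · exact he.elim
        · exact he.elim
        · by_cases hxa : x = a
          · rw [hxa, hfa, Set.inter_comm]
            refine hull_inter_hull_subset σ v a v (orient_self_left _ _) ?_ ?_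
            · rintro z (rfl | rfl | hz)
              · right; linarith
              · exact Or.inl rfl
              · exact Or.inr (lt_of_le_of_ne (hK2 z hz.2.2.2)
                  (mul_ne_zero hσ (hS.orient_ne_zero hav.symm hz.2.1.symm hz.2.2.1.symm)).symm)
            · intro z hz
              rcases Sym2.mem_iff.1 hz with rfl | rfl
              · simp [orient_self_right]
              · simp [orient_self_left]
          · refine (Set.inter_subset_inter_right _ hsub₁).trans (hout x fun h => ?_)
            simp at hx
            rcases hmemK x h with h | h | h | h <;> tauto }
  have s₁ : Linked (layoutGraph [u, v] f) (layoutGraph [u, v] (reattach Q v f)) := m₁.linked hS hT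
  set f₁ := reattach Q v f with hf₁
  have hL₁ : IsLayout [u, v] f₁ := hL.reattach (by simp) _
  have hf₁' : ∀ x, x ∉ Q → f₁ x = f x := fun x hx => reattach_of_notMem hx
  -- Now every point of `S` in the triangle other than `u` and `v` is a leaf of `v`.
  have m₂ : Movable (-σ) [] v u [] f₁ (insert a Q) :=
    { layout := hL₁.reverse
      off := by
        rintro z (rfl | hz)
        · simp [hau, hav]
        · simp [hz.1, hz.2.1]
      attached := by
        rintro z (rfl | hz)
        · rw [hf₁' _ fun h => h.2.2.1 rfl, hfa]
        · exact reattach_of_mem hz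
      side := by
        rintro z (rfl | hz)
        · rw [orient_swap]; linarith
        · have := hside z hz.1 hz.2.1 (hK1 z hz.2.2.2)
          rw [orient_swap]; linarith
      closed := fun p hp => by
        rcases hmemK p (hsub₂ hp) with h | h | h | h <;> simp [h]
      free := by
        rintro e ((he | he) | ⟨x, hx, hxQ, rfl⟩)
        · exact he.elim
        · exact he.elim
        · rw [hf₁' x fun h => hxQ (Or.inr h)]
          refine (Set.inter_subset_inter_right _ hsub₂).trans (hout x fun h => ?_)
          simp at hx hxQ
          rcases hmemK x h with h | h | h | h <;> tauto }
  have s₂ : Linked (layoutGraph [u, v].reverse f₁)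
      (layoutGraph [u, v].reverse (reattach (insert a Q) u f₁)) :=
    m₂.linked hS (by
      change Linked (layoutGraph [u, v].reverse f₁) (layoutGraph [u, v].reverse f₁)
      rw [layoutGraph_reverse]; exact s₁.right)
  rw [layoutGraph_reverse, layoutGraph_reverse] at s₂
  have hkey : ∀ x, reattach (insert a Q) u f₁ x = v → x ≠ a ∧ f x = v := by
    intro x hx
    by_cases h : x ∈ insert a Q
    · rw [reattach_of_mem h] at hx; exact absurd hx huv
    · rw [reattach_of_notMem h, hf₁' x fun h' => h (Or.inr h')] at hx
      exact ⟨fun h' => h (Or.inl h'), hx⟩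
  refine (s₁.trans s₂).trans (ih {x | x ≠ u ∧ x ≠ v ∧ reattach (insert a Q) u f₁ x = v}
    ⟨fun x hx => ?_, fun h => ?_⟩ rfl (hL₁.reattach (by simp) _) s₂.right)
  · rw [hW]; exact ⟨hx.1, hx.2.1, (hkey x hx.2.2).2⟩
  · exact (hkey a (h haW).2.2).1 rfl

/-! ### Stars and double stars as layouts -/

/-- The list of a layout may end in a leaf of the tree, here `v`, so the star shares the spine `[u,
v]` with the double stars. -/
theorem layoutGraph_eq_starGraph {u v : V} (huv : u ≠ v) :
    layoutGraph [u, v] (fun _ => u) = SimpleGraph.starGraph u := by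
  have hL : IsLayout [u, v] (fun _ => u) := ⟨by simp [huv], fun _ _ => by simp⟩
  ext x y
  rw [hL.adj_iff, SimpleGraph.starGraph_adj]
  constructor
  · rintro ((he | he) | ⟨z, hz, he⟩)
    · rcases Sym2.eq_iff.1 he with ⟨rfl, rfl⟩ | ⟨rfl, rfl⟩ <;> simp [huv, huv.symm]
    · exact he.elim
    · simp at hz
      rcases Sym2.eq_iff.1 he with ⟨rfl, rfl⟩ | ⟨rfl, rfl⟩ <;> simp [hz, Ne.symm hz.1]
  · rintro ⟨hne, rfl | rfl⟩
    · by_cases h : y = v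
      · subst h; exact Or.inl (Or.inl rfl)
      · exact Or.inr ⟨y, by simp [h, hne.symm], Sym2.eq_swap⟩
    · by_cases h : x = v
      · subst h; exact Or.inl (Or.inl Sym2.eq_swap)
      · exact Or.inr ⟨x, by simp [h, hne], rfl⟩

theorem IsDoubleStar.symm {T : SimpleGraph V} {u v : V} (h : IsDoubleStar T u v) :
    IsDoubleStar T v u := ⟨h.1, h.2.1.symm, fun x hv hu => h.2.2 x hu hv⟩

/-- A vertex of a double star other than the centers is adjacent only to centers. -/
theorem IsDoubleStar.eq_or_eq {T : SimpleGraph V} {u v x y : V} (h : IsDoubleStar T u v)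
    (hxu : x ≠ u) (hxv : x ≠ v) (hxy : T.Adj x y) : y = u ∨ y = v := by
  by_contra! hy
  have huniq : ∀ {a b c}, a ≠ u → a ≠ v → T.Adj a b → T.Adj a c → b = c :=
    fun hu hv hb hc => (h.2.2 _ hu hv).unique hb hc
  -- If `y` were a leaf too, `x` and `y` would form a whole component, cut off from `u`.
  have hcl : ∀ {z w}, T.Walk z w → (z = x ∨ z = y) → w = x ∨ w = y := by
    intro z w p
    induction p with
    | nil => exact id
    | cons hadj _ ih =>
      rintro (rfl | rfl)
      · exact ih (Or.inr (huniq hxu hxv hadj hxy))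
      · exact ih (Or.inl (huniq hy.1 hy.2 hadj hxy.symm))
  obtain ⟨p⟩ := h.1.connected.preconnected x u
  rcases hcl p (Or.inl rfl) with h' | h'
  · exact hxu h'.symm
  · exact hy.1 h'.symm

theorem IsDoubleStar.exists_layout {T : SimpleGraph V} {u v : V} (h : IsDoubleStar T u v) :
    ∃ f, IsLayout [u, v] f ∧ T = layoutGraph [u, v] f := by
  classical
  have huv : u ≠ v := h.2.1.ne
  have hex : ∀ x, ∃ y, x ≠ u → x ≠ v → T.Adj x y := by
    intro x
    by_cases hx : x ≠ u ∧ x ≠ v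
    · obtain ⟨y, hy, -⟩ := h.2.2 x hx.1 hx.2
      exact ⟨y, fun _ _ => hy⟩
    · exact ⟨x, fun h1 h2 => absurd ⟨h1, h2⟩ hx⟩
  choose f hf using hex
  have hL : IsLayout [u, v] f := ⟨by simp [huv], fun x hx => by
    simp only [List.mem_cons, List.not_mem_nil, or_false, not_or] at hx ⊢
    exact h.eq_or_eq hx.1 hx.2 (hf x hx.1 hx.2)⟩
  have hleaf : ∀ x y, x ≠ u → x ≠ v → T.Adj x y → s(x, y) ∈ layoutEdges [u, v] f :=
    fun x y hxu hxv hxy => Or.inr ⟨x, by simp [hxu, hxv], by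
      rw [(h.2.2 x hxu hxv).unique hxy (hf x hxu hxv)]⟩
  refine ⟨f, hL, ?_⟩
  ext x y
  rw [hL.adj_iff]
  constructor
  · intro hxy
    by_cases hx : x ≠ u ∧ x ≠ v
    · exact hleaf x y hx.1 hx.2 hxy
    by_cases hy : y ≠ u ∧ y ≠ v
    · rw [Sym2.eq_swap]; exact hleaf y x hy.1 hy.2 hxy.symm
    have hne := hxy.ne
    have : s(x, y) = s(u, v) := by
      rw [Sym2.eq_iff]
      by_cases h1 : x = u <;> by_cases h2 : x = v <;> by_cases h3 : y = u <;>
        by_cases h4 : y = v <;> simp_all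
    exact Or.inl (Or.inl this)
  · rintro ((he | he) | ⟨z, hz, he⟩)
    · rw [← SimpleGraph.mem_edgeSet, he]; exact h.2.1
    · exact he.elim
    · simp only [List.mem_cons, List.not_mem_nil, or_false, not_or] at hz
      rw [← SimpleGraph.mem_edgeSet, he]; exact hf z hz.1 hz.2

theorem reachable_star_of_isDoubleStar (hS : GeneralPosition S) {u v : S}
    (C : PlaneCaterpillar S) (hC : IsDoubleStar C.1 u v) :
    (slideGraph S).Reachable (star hS u) C := by
  obtain ⟨f, hL, hf⟩ := hC.exists_layout
  have huv : u ≠ v := hC.2.1.ne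
  have hT : Linked C.1 C.1 := ⟨C.2, C.2, SimpleGraph.Reachable.refl _⟩
  have hlink : Linked C.1 (SimpleGraph.starGraph u) := by
    rw [← layoutGraph_eq_starGraph huv]
    rw [hf] at hT ⊢
    exact linked_star hS huv rfl hL hT
  obtain ⟨_, _, r⟩ := hlink
  exact r.symm

end CaterpillarSlide

theorem lemma3 (S : Finset CaterpillarSlide.Plane) (hS : CaterpillarSlide.GeneralPosition S) :
    (∀ u v : S, CaterpillarSlide.HullAdjacent S u v →
      ∀ C : CaterpillarSlide.PlaneCaterpillar S, CaterpillarSlide.IsDoubleStar C.1 u v →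
        (CaterpillarSlide.slideGraph S).Reachable (CaterpillarSlide.star hS u) C ∧
        (CaterpillarSlide.slideGraph S).Reachable (CaterpillarSlide.star hS v) C) ∧
    (∀ u v : S, u ≠ v →
      ∀ C : CaterpillarSlide.PlaneCaterpillar S, CaterpillarSlide.IsDoubleStar C.1 u v →
        (CaterpillarSlide.slideGraph S).Reachable (CaterpillarSlide.star hS u) C ∧
        (CaterpillarSlide.slideGraph S).Reachable (CaterpillarSlide.star hS v) C) :=
  ⟨fun _ _ _ C hC => ⟨CaterpillarSlide.reachable_star_of_isDoubleStar hS C hC,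
      CaterpillarSlide.reachable_star_of_isDoubleStar hS C hC.symm⟩,
    fun _ _ _ C hC => ⟨CaterpillarSlide.reachable_star_of_isDoubleStar hS C hC,
      CaterpillarSlide.reachable_star_of_isDoubleStar hS C hC.symm⟩⟩
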